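/- Let $k_1,k_2\in(-\tfrac12,\tfrac12)$ and let $\alpha,\gamma,\alpha',\gamma'\in\mathbb C$ satisfy $\alpha\gamma=\alpha'\gamma'=\tfrac12$. On $\mathbb R^2$ put $$W_1=-\tfrac x2-ik_1y,\quad W_2=-\tfrac y2-ik_2x,\quad V_1=-\tfrac x2+ik_1y,\quad V_2=-\tfrac y2+ik_2x,$$ $p_x=-i\partial_x$, $p_y=-i\partial_y$, $P'=p_x+W_2$, $Q'=p_y-W_1$, $P=p_y+V_1$, $Q=p_x-V_2$, and $$A=\alpha(Q+iP),\quad B=\gamma(Q-iP),\quad A'=\alpha'(Q'+iP'),\quad B'=\gamma'(Q'-iP'),$$ $$h=\tfrac12(Q^2+P^2),\quad h'=\tfrac12(P'^2+Q'^2),\quad N=BA,\quad N'=B'A'.$$ These are regarded as operators in $L^2(\mathbb R^2)$ with the Schwartz space $\mathcal S(\mathbb R^2)$ as (dense) domain, $^\dagger$ is the Hilbert space adjoint, and products and powers have their natural domains. Let $N_\varphi,N_\Psi\in\mathbb C$ be such that the functions $$\varphi_{0,0}=N_\varphi\,e^{-\frac{x^2}4(1+2k_2)-\frac{y^2}4(1-2k_1)},\qquad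 \Psi_{0,0}=N_\Psi\,e^{-\frac{x^2}4(1-2k_2)-\frac{y^2}4(1+2k_1)}$$ satisfy $\langle\varphi_{0,0},\Psi_{0,0}\rangle=1$. Then: 1. On $\mathcal S(\mathbb R^2)$, $[A,B]=[A',B']=1$, each of $A,B$ commutes with each of $A',B'$, and $h=N+\tfrac12$, $h'=N'+\tfrac12$. 2. $\varphi_{0,0}$ and $\Psi_{0,0}$ are nonzero elements of $L^2(\mathbb R^2)$ with $A\varphi_{0,0}=A'\varphi_{0,0}=0$ and $B^\dagger\Psi_{0,0}=B'^\dagger\Psi_{0,0}=0$; $\varphi_{0,0}$ lies in the domain of all powers of $B$ and of $B'$, and $\Psi_{0,0}$ in the domain of all powers of $A^\dagger$ and of $A'^\dagger$. For all $n,l\ge0$ the vectors $$\varphi_{n,l}=\frac{B'^nB^l}{\sqrt{n!\,l!}}\,\varphi_{0,0},\qquad \Psi_{n,l}=\frac{(A'^\dagger)^n(A^\dagger)^l}{\sqrt{n!\,l!}}\,\Psi_{0,0}$$ are well defined in $L^2(\mathbb R^2)$. 3. $\langle\Psi_{n,l},\varphi_{m,k}\rangle=\delta_{n,m}\delta_{l,k}$,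 and both families $\{\varphi_{n,l}\}$ and $\{\Psi_{n,l}\}$ are complete, i.e. have dense linear span in $L^2(\mathbb R^2)$. 4. $N\varphi_{n,l}=l\varphi_{n,l}$, $N'\varphi_{n,l}=n\varphi_{n,l}$, $N^\dagger\Psi_{n,l}=A^\dagger B^\dagger\Psi_{n,l}=l\Psi_{n,l}$, $N'^\dagger\Psi_{n,l}=A'^\dagger B'^\dagger\Psi_{n,l}=n\Psi_{n,l}$; consequently $h\varphi_{n,l}=(l+\tfrac12)\varphi_{n,l}$, $h'\varphi_{n,l}=(n+\tfrac12)\varphi_{n,l}$, $h^\dagger\Psi_{n,l}=(l+\tfrac12)\Psi_{n,l}$, $h'^\dagger\Psi_{n,l}=(n+\tfrac12)\Psi_{n,l}$. 5. Let $\varphi^{(0)}_{n,l}$ be the vectors $\varphi_{n,l}$ for $k_1=k_2=0$, $\alpha=\gamma=\alpha'=\gamma'=1/\sqrt2$, $N_\varphi=1/\sqrt{2\pi}$ (standard Landau levels). They form an orthonormal, complete family. Consider the operators of multiplication, each on its maximal domain in $L^2(\mathbb R^2)$, by $$T_\varphi=\sqrt{2\pi}\,N_\varphi\,e^{-\frac{x^2}2k_2+\frac{y^2}2k_1},\quad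 T_\Psi=\sqrt{2\pi}\,N_\Psi\,e^{\frac{x^2}2k_2-\frac{y^2}2k_1},\quad S_\varphi=\frac{N_\varphi}{N_\Psi}e^{-x^2k_2+y^2k_1},\quad S_\Psi=\frac{N_\Psi}{N_\varphi}e^{x^2k_2-y^2k_1}.$$ Then $$T_\varphi\big[(\sqrt2\gamma')^n(\sqrt2\gamma)^l\varphi^{(0)}_{n,l}\big]=\varphi_{n,l},\qquad T_\Psi\big[(\sqrt2\,\overline{\alpha'})^n(\sqrt2\,\overline\alpha)^l\varphi^{(0)}_{n,l}\big]=\Psi_{n,l},$$ $$S_\varphi\Psi_{n,l}=\Big(\frac{\overline{\alpha'}}{\gamma'}\Big)^n\Big(\frac{\overline\alpha}{\gamma}\Big)^l\varphi_{n,l},\qquad S_\Psi\varphi_{n,l}=\Big(\frac{\gamma'}{\overline{\alpha'}}\Big)^n\Big(\frac{\gamma}{\overline\alpha}\Big)^l\Psi_{n,l}$$ (for $\alpha=\gamma=\alpha'=\gamma'=1/\sqrt2$ all these scalar factors are $1$). Moreover $S_\Psi N=N^\dagger S_\Psi$ and $S_\Psi N'=N'^\dagger S_\Psi$ on the linear span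 of $\{\varphi_{n,l}\}$, and $S_\varphi N^\dagger=NS_\varphi$ and $S_\varphi N'^\dagger=N'S_\varphi$ on the linear span of $\{\Psi_{n,l}\}$. 6. $T_\varphi$ and $T_\varphi^{-1}$ are both bounded if and only if $k_1=k_2=0$; the same holds for the pair $T_\Psi,T_\Psi^{-1}$ and for the pair $S_\varphi,S_\Psi=S_\varphi^{-1}$. So, unless $k_1=k_2=0$, at least one operator in each pair is unbounded. 7. Unless $k_1=k_2=0$, neither $\{\varphi_{n,l}\}$ nor $\{\Psi_{n,l}\}$ is a Riesz basis of $L^2(\mathbb R^2)$, i.e. the image of an orthonormal basis under a bounded operator with bounded inverse. -/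

import Mathlib

open MeasureTheory Complex LineDeriv
open scoped SchwartzMap ComplexConjugate ComplexInnerProductSpace LinearPMap

noncomputable section

namespace Landau

/-- The Hilbert space `L²(ℝ²)`, with Lebesgue measure on `ℝ × ℝ`. -/
abbrev Hil := Lp ℂ 2 (volume : Measure (ℝ × ℝ))

/-- Schwartz functions on the plane. -/
abbrev Sch := 𝓢(ℝ × ℝ, ℂ)

/-! ### Partially defined operators -/

section PartialOperators

variable {E : Type*} [NormedAddCommGroup E] [NormedSpace ℂ E]

/-- `T` is defined at `x` and maps it to `y`. -/
def Maps (T : E →ₗ.[ℂ] E) (x y : E) : Prop :=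
  ∃ h : x ∈ T.domain, T ⟨x, h⟩ = y

/-- The product `S T`, on its natural domain `{x ∈ D(T) | T x ∈ D(S)}`. -/
def prodOp (S T : E →ₗ.[ℂ] E) : E →ₗ.[ℂ] E where
  domain :=
    { carrier := {x | ∃ h : x ∈ T.domain, T ⟨x, h⟩ ∈ S.domain}
      zero_mem' := ⟨T.domain.zero_mem, by
        have : T ⟨0, T.domain.zero_mem⟩ = 0 := T.map_zero
        rw [this]; exact S.domain.zero_mem⟩
      add_mem' := by
        rintro x y ⟨hx, hx'⟩ ⟨hy, hy'⟩
        refine ⟨T.domain.add_mem hx hy, ?_⟩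
        have : T ⟨x + y, T.domain.add_mem hx hy⟩ = T ⟨x, hx⟩ + T ⟨y, hy⟩ :=
          T.map_add ⟨x, hx⟩ ⟨y, hy⟩
        rw [this]; exact S.domain.add_mem hx' hy'
      smul_mem' := by
        rintro c x ⟨hx, hx'⟩
        refine ⟨T.domain.smul_mem c hx, ?_⟩
        have : T ⟨c • x, T.domain.smul_mem c hx⟩ = c • T ⟨x, hx⟩ := T.map_smul c ⟨x, hx⟩
        rw [this]; exact S.domain.smul_mem c hx' }
  toFun :=
    { toFun := fun x => S ⟨T ⟨x.1, x.2.1⟩, x.2.2⟩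
      map_add' := fun x y => by
        rw [← S.map_add]
        exact congrArg S (Subtype.ext (T.map_add ⟨x.1, x.2.1⟩ ⟨y.1, y.2.1⟩))
      map_smul' := fun c x => by
        rw [RingHom.id_apply, ← S.map_smul]
        exact congrArg S (Subtype.ext (T.map_smul c ⟨x.1, x.2.1⟩)) }

/-- The power `T ^ n`, on its natural domain. -/
def powOp (T : E →ₗ.[ℂ] E) : ℕ → (E →ₗ.[ℂ] E)
  | 0 => LinearMap.id.toPMap ⊤
  | n + 1 => prodOp T (powOp T n)

/-- Membership in `D^∞(T) = ⋂ₙ D(Tⁿ)`. -/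
def MemDInf (T : E →ₗ.[ℂ] E) (x : E) : Prop :=
  ∀ n, x ∈ (powOp T n).domain

/-- Boundedness of a (partially defined) operator on its domain. -/
def IsBoundedOp (T : E →ₗ.[ℂ] E) : Prop :=
  ∃ C : ℝ, ∀ x : T.domain, ‖T x‖ ≤ C * ‖(x : E)‖

/-- `S` intertwines `M` and `N` on the subspace `D`: `S M f = N S f` for `f ∈ D`, where both
sides are defined. -/
def IntertwinesOn (D : Submodule ℂ E) (S M N : E →ₗ.[ℂ] E) : Prop :=
  ∀ f ∈ D, ∃ g, Maps (prodOp S M) f g ∧ Maps (prodOp N S) f g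

end PartialOperators

/-- The operator of multiplication by the function `m`, on its maximal domain
`{f ∈ L² | m f ∈ L²}`. -/
def mulOp (m : ℝ × ℝ → ℂ) : Hil →ₗ.[ℂ] Hil where
  domain :=
    { carrier := {f | MemLp (fun p => m p * f p) 2 volume}
      zero_mem' := by
        refine (memLp_congr_ae ?_).2 (MemLp.zero (ε := ℂ) (p := 2) (μ := volume) (α := ℝ × ℝ))
        filter_upwards [Lp.coeFn_zero ℂ 2 (volume : Measure (ℝ × ℝ))] with p hp
        simp
      add_mem' := by
        intro f g hf hg
        refine (memLp_congr_ae ?_).2 (MemLp.add hf hg)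
        filter_upwards [Lp.coeFn_add f g] with p hp
        rw [hp]; exact mul_add _ _ _
      smul_mem' := by
        intro c f hf
        refine (memLp_congr_ae ?_).2 (MemLp.const_smul hf c)
        filter_upwards [Lp.coeFn_smul c f] with p hp
        simp only [hp, Pi.smul_apply, smul_eq_mul]; ring }
  toFun :=
    { toFun := fun f => MemLp.toLp _ f.2
      map_add' := fun f g => by
        rw [← MemLp.toLp_add, MemLp.toLp_eq_toLp_iff]
        filter_upwards [Lp.coeFn_add f.1 g.1] with p hp
        change m p * (f.1 + g.1 : Hil) p = _
        rw [hp]; exact mul_add _ _ _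
      map_smul' := fun c f => by
        rw [RingHom.id_apply, ← MemLp.toLp_const_smul, MemLp.toLp_eq_toLp_iff]
        filter_upwards [Lp.coeFn_smul c f.1] with p hp
        simp only [Submodule.coe_smul, hp, Pi.smul_apply, smul_eq_mul]; ring }

/-- The inclusion of Schwartz functions in `L²(ℝ²)`. -/
def incl : Sch →ₗ[ℂ] Hil := (SchwartzMap.toLpCLM ℂ ℂ 2 (volume : Measure (ℝ × ℝ))).toLinearMap

lemma incl_injective : Function.Injective incl := by
  intro f g h
  exact SchwartzMap.injective_toLp (E := ℝ × ℝ) (F := ℂ) 2 volume h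

/-- A linear operator on Schwartz functions, seen as a densely defined operator in `L²(ℝ²)`
with the Schwartz space as its domain. -/
def onL2 (T : Sch →ₗ[ℂ] Sch) : Hil →ₗ.[ℂ] Hil where
  domain := LinearMap.range incl
  toFun := incl ∘ₗ T ∘ₗ (LinearEquiv.ofInjective incl incl_injective).symm.toLinearMap

/-! ### The superpotentials and the differential operators -/

/-- `W₁(x, y) = -x/2 - i k₁ y`. -/
def W₁ (k₁ : ℝ) (p : ℝ × ℝ) : ℂ := -p.1 / 2 - I * k₁ * p.2

/-- `W₂(x, y) = -y/2 - i k₂ x`. -/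
def W₂ (k₂ : ℝ) (p : ℝ × ℝ) : ℂ := -p.2 / 2 - I * k₂ * p.1

/-- `V₁(x, y) = -x/2 + i k₁ y`. -/
def V₁ (k₁ : ℝ) (p : ℝ × ℝ) : ℂ := -p.1 / 2 + I * k₁ * p.2

/-- `V₂(x, y) = -y/2 + i k₂ x`. -/
def V₂ (k₂ : ℝ) (p : ℝ × ℝ) : ℂ := -p.2 / 2 + I * k₂ * p.1

/-- `p_x = -i ∂_x`. -/
def momX : Sch →ₗ[ℂ] Sch := (-I) • (lineDerivOpCLM ℂ Sch ((1, 0) : ℝ × ℝ)).toLinearMap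

/-- `p_y = -i ∂_y`. -/
def momY : Sch →ₗ[ℂ] Sch := (-I) • (lineDerivOpCLM ℂ Sch ((0, 1) : ℝ × ℝ)).toLinearMap

/-- Multiplication of Schwartz functions by a function of temperate growth. -/
def mulS (w : ℝ × ℝ → ℂ) : Sch →ₗ[ℂ] Sch := (SchwartzMap.smulLeftCLM ℂ w).toLinearMap

lemma temperate_affine (a b : ℂ) :
    Function.HasTemperateGrowth (fun p : ℝ × ℝ => a * p.1 + b * p.2) := by
  have h1 : Function.HasTemperateGrowth (fun p : ℝ × ℝ => (p.1 : ℂ)) :=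
    (ofRealCLM.comp (ContinuousLinearMap.fst ℝ ℝ ℝ)).hasTemperateGrowth
  have h2 : Function.HasTemperateGrowth (fun p : ℝ × ℝ => (p.2 : ℂ)) :=
    (ofRealCLM.comp (ContinuousLinearMap.snd ℝ ℝ ℝ)).hasTemperateGrowth
  exact ((Function.HasTemperateGrowth.const a).mul h1).add
    ((Function.HasTemperateGrowth.const b).mul h2)

lemma mulS_affine_apply (a b : ℂ) (f : Sch) (p : ℝ × ℝ) :
    mulS (fun p : ℝ × ℝ => a * p.1 + b * p.2) f p = (a * p.1 + b * p.2) * f p :=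
  SchwartzMap.smulLeftCLM_apply_apply (temperate_affine a b) f p

lemma mulS_W₁ (k : ℝ) (f : Sch) (p : ℝ × ℝ) : mulS (W₁ k) f p = W₁ k p * f p := by
  have h : W₁ k = fun p : ℝ × ℝ => (-1 / 2 : ℂ) * p.1 + (-I * k) * p.2 := by
    funext q; simp only [W₁]; ring
  rw [h]; exact mulS_affine_apply _ _ f p

lemma mulS_W₂ (k : ℝ) (f : Sch) (p : ℝ × ℝ) : mulS (W₂ k) f p = W₂ k p * f p := by
  have h : W₂ k = fun p : ℝ × ℝ => (-I * k) * p.1 + (-1 / 2 : ℂ) * p.2 := by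
    funext q; simp only [W₂]; ring
  rw [h]; exact mulS_affine_apply _ _ f p

lemma mulS_V₁ (k : ℝ) (f : Sch) (p : ℝ × ℝ) : mulS (V₁ k) f p = V₁ k p * f p := by
  have h : V₁ k = fun p : ℝ × ℝ => (-1 / 2 : ℂ) * p.1 + (I * k) * p.2 := by
    funext q; simp only [V₁]; ring
  rw [h]; exact mulS_affine_apply _ _ f p

lemma mulS_V₂ (k : ℝ) (f : Sch) (p : ℝ × ℝ) : mulS (V₂ k) f p = V₂ k p * f p := by
  have h : V₂ k = fun p : ℝ × ℝ => (I * k) * p.1 + (-1 / 2 : ℂ) * p.2 := by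
    funext q; simp only [V₂]; ring
  rw [h]; exact mulS_affine_apply _ _ f p

/-- The parameters of the model: the perturbation `k₁, k₂`, the constants `α, γ, α', γ'` in the
ladder operators and the constants `Nφ, NΨ` in the vacua. -/
structure Model where
  k₁ : ℝ
  k₂ : ℝ
  α : ℂ
  γ : ℂ
  α' : ℂ
  γ' : ℂ
  Nφ : ℂ
  NΨ : ℂ

/-- The unperturbed model (standard Landau levels). -/
def sll : Model where
  k₁ := 0
  k₂ := 0
  α := (1 / √2 : ℝ)
  γ := (1 / √2 : ℝ)
  α' := (1 / √2 : ℝ)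
  γ' := (1 / √2 : ℝ)
  Nφ := (1 / √(2 * Real.pi) : ℝ)
  NΨ := (1 / √(2 * Real.pi) : ℝ)

namespace Model

variable (M : Model)

/-! Operators on Schwartz functions. -/

/-- `P' = p_x + W₂`. -/
def sP' : Sch →ₗ[ℂ] Sch := momX + mulS (W₂ M.k₂)

/-- `Q' = p_y - W₁`. -/
def sQ' : Sch →ₗ[ℂ] Sch := momY - mulS (W₁ M.k₁)

/-- `P = p_y + V₁`. -/
def sP : Sch →ₗ[ℂ] Sch := momY + mulS (V₁ M.k₁)

/-- `Q = p_x - V₂`. -/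
def sQ : Sch →ₗ[ℂ] Sch := momX - mulS (V₂ M.k₂)

/-- `A = α (Q + i P)`. -/
def sA : Sch →ₗ[ℂ] Sch := M.α • (M.sQ + I • M.sP)

/-- `B = γ (Q - i P)`. -/
def sB : Sch →ₗ[ℂ] Sch := M.γ • (M.sQ - I • M.sP)

/-- `A' = α' (Q' + i P')`. -/
def sA' : Sch →ₗ[ℂ] Sch := M.α' • (M.sQ' + I • M.sP')

/-- `B' = γ' (Q' - i P')`. -/
def sB' : Sch →ₗ[ℂ] Sch := M.γ' • (M.sQ' - I • M.sP')

/-- `h = (1/2) (p_x - V₂)² + (1/2) (p_y + V₁)²`. -/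
def sH : Sch →ₗ[ℂ] Sch := (1 / 2 : ℂ) • (M.sQ ∘ₗ M.sQ) + (1 / 2 : ℂ) • (M.sP ∘ₗ M.sP)

/-- `h' = (1/2) (p_x + W₂)² + (1/2) (p_y - W₁)²`. -/
def sH' : Sch →ₗ[ℂ] Sch :=
  (1 / 2 : ℂ) • (M.sP' ∘ₗ M.sP') + (1 / 2 : ℂ) • (M.sQ' ∘ₗ M.sQ')

/-! The corresponding operators in `L²(ℝ²)`. -/

/-- `A` as an operator in `L²(ℝ²)`. -/
def A : Hil →ₗ.[ℂ] Hil := onL2 M.sA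

/-- `B` as an operator in `L²(ℝ²)`. -/
def B : Hil →ₗ.[ℂ] Hil := onL2 M.sB

/-- `A'` as an operator in `L²(ℝ²)`. -/
def A' : Hil →ₗ.[ℂ] Hil := onL2 M.sA'

/-- `B'` as an operator in `L²(ℝ²)`. -/
def B' : Hil →ₗ.[ℂ] Hil := onL2 M.sB'

/-- `h` as an operator in `L²(ℝ²)`. -/
def h : Hil →ₗ.[ℂ] Hil := onL2 M.sH

/-- `h'` as an operator in `L²(ℝ²)`. -/
def h' : Hil →ₗ.[ℂ] Hil := onL2 M.sH'

/-- `N = B A`. -/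
def N : Hil →ₗ.[ℂ] Hil := prodOp M.B M.A

/-- `N' = B' A'`. -/
def N' : Hil →ₗ.[ℂ] Hil := prodOp M.B' M.A'

/-! Vacua and multiplication operators. -/

/-- The Gaussian `Nφ exp(-(x²/4)(1 + 2k₂) - (y²/4)(1 - 2k₁))`. -/
def vacφ (p : ℝ × ℝ) : ℂ :=
  M.Nφ * Real.exp (-(p.1 ^ 2 / 4) * (1 + 2 * M.k₂) - (p.2 ^ 2 / 4) * (1 - 2 * M.k₁))

/-- The Gaussian `NΨ exp(-(x²/4)(1 - 2k₂) - (y²/4)(1 + 2k₁))`. -/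
def vacΨ (p : ℝ × ℝ) : ℂ :=
  M.NΨ * Real.exp (-(p.1 ^ 2 / 4) * (1 - 2 * M.k₂) - (p.2 ^ 2 / 4) * (1 + 2 * M.k₁))

/-- Multiplication by `√(2π) Nφ exp(-(x² k₂ - y² k₁)/2)`. -/
def Tφ : Hil →ₗ.[ℂ] Hil :=
  mulOp fun p => √(2 * Real.pi) * M.Nφ * Real.exp (-(p.1 ^ 2 * M.k₂ - p.2 ^ 2 * M.k₁) / 2)

/-- Multiplication by `(√(2π) Nφ)⁻¹ exp((x² k₂ - y² k₁)/2)`, the inverse of `Tφ`. -/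
def TφInv : Hil →ₗ.[ℂ] Hil :=
  mulOp fun p => (√(2 * Real.pi) * M.Nφ)⁻¹ * Real.exp ((p.1 ^ 2 * M.k₂ - p.2 ^ 2 * M.k₁) / 2)

/-- Multiplication by `√(2π) NΨ exp((x² k₂ - y² k₁)/2)`. -/
def TΨ : Hil →ₗ.[ℂ] Hil :=
  mulOp fun p => √(2 * Real.pi) * M.NΨ * Real.exp ((p.1 ^ 2 * M.k₂ - p.2 ^ 2 * M.k₁) / 2)

/-- Multiplication by `(√(2π) NΨ)⁻¹ exp(-(x² k₂ - y² k₁)/2)`, the inverse of `TΨ`. -/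
def TΨInv : Hil →ₗ.[ℂ] Hil :=
  mulOp fun p => (√(2 * Real.pi) * M.NΨ)⁻¹ * Real.exp (-(p.1 ^ 2 * M.k₂ - p.2 ^ 2 * M.k₁) / 2)

/-- Multiplication by `(Nφ / NΨ) exp(-(x² k₂ - y² k₁))`. -/
def Sφ : Hil →ₗ.[ℂ] Hil :=
  mulOp fun p => M.Nφ / M.NΨ * Real.exp (-(p.1 ^ 2 * M.k₂ - p.2 ^ 2 * M.k₁))

/-- Multiplication by `(NΨ / Nφ) exp(x² k₂ - y² k₁)`. -/
def SΨ : Hil →ₗ.[ℂ] Hil :=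
  mulOp fun p => M.NΨ / M.Nφ * Real.exp (p.1 ^ 2 * M.k₂ - p.2 ^ 2 * M.k₁)

/-- `φ` is the family `φ_{n,l} = B'ⁿ Bˡ φ_{0,0} / √(n! l!)`, where `φ_{0,0}` is the Gaussian
`vacφ` and all the products are defined. -/
def IsφFamily (φ : ℕ × ℕ → Hil) : Prop :=
  φ (0, 0) =ᵐ[volume] M.vacφ ∧
  ∀ n l : ℕ, Maps (prodOp (powOp M.B' n) (powOp M.B l)) (φ (0, 0))
    ((√(n.factorial * l.factorial) : ℂ) • φ (n, l))

/-- `Ψ` is the family `Ψ_{n,l} = (A'†)ⁿ (A†)ˡ Ψ_{0,0} / √(n! l!)`, where `Ψ_{0,0}` is the Gaussian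
`vacΨ` and all the products are defined. -/
def IsΨFamily (Ψ : ℕ × ℕ → Hil) : Prop :=
  Ψ (0, 0) =ᵐ[volume] M.vacΨ ∧
  ∀ n l : ℕ, Maps (prodOp (powOp M.A'† n) (powOp M.A† l)) (Ψ (0, 0))
    ((√(n.factorial * l.factorial) : ℂ) • Ψ (n, l))

end Model

/-! ### Riesz bases and complete families -/

/-- A family is a Riesz basis if it is the image of an orthonormal basis under a bounded
operator with bounded inverse. -/
def IsRieszBasis {ι : Type*} (f : ι → Hil) : Prop :=
  ∃ (V : Hil ≃L[ℂ] Hil) (e : HilbertBasis ι ℂ Hil), ∀ i, f i = V (e i)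

/-- The linear span of the family is dense. -/
def IsCompleteFamily {ι : Type*} (f : ι → Hil) : Prop :=
  (Submodule.span ℂ (Set.range f)).topologicalClosure = ⊤

end Landau

end

noncomputable section

namespace Landau

/-! ### Operators on Schwartz functions as partially defined operators -/

section Lifts

/-! Every operator involved is a first order differential operator with constant derivative
coefficients and a linear zeroth order term, so it preserves Schwartz space, commutators are scalars
(`fstOrd_comm`) and formal adjoints are explicit (`isAdj_fstOrd`). Passing to adjoints amounts to
replacing the model by `Model.dual`, with `k₁, k₂` negated and the constants conjugated and
exchanged. Hence the family `Ψ` of a model is the family `φ` of its dual, and only `φ` has to be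
studied. Biorthogonality is the usual ladder argument (`pairing_state`).

Completeness: multiplication by `x ± i y` is a combination of ladder operators, so the span of the
states contains every polynomial times the vacuum. If `f` is orthogonal to the span, `conj f` times
the vacuum has vanishing moments and exponential decay; its Fourier transform vanishes, and so does
`f`.

The multiplication operators come from a Gaussian `gauge`, which conjugates the creation operators
into those of the standard Landau levels, up to scalars. A continuous multiplier gives a bounded
operator only if it is a bounded function, and a Gaussian factor and its inverse are both bounded
only when constant.

For a Riesz basis, the products of its norms with those of a biorthogonal family are bounded
(`IsRieszBasis.exists_bound`). Here `φ_{n,0}` is a power of `x + i y` times a Gaussian, so its norm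
is a Gaussian moment. On the unit circle the quadratic forms in the squared vacua of `φ` and `Ψ` add
up to `1`; in a direction where they are `1/2 + q` and `1/2 - q` with `q ≠ 0`, restricting both
moments to a narrow sector shows that the product of norms grows geometrically, since `4 (1/2 +
q)(1/2 - q) < 1`. -/

lemma maps_onL2 (T : Sch →ₗ[ℂ] Sch) (f : Sch) : Maps (onL2 T) (incl f) (incl (T f)) := by
  refine ⟨⟨f, rfl⟩, ?_⟩
  have : (LinearEquiv.ofInjective incl incl_injective).symm ⟨incl f, ⟨f, rfl⟩⟩ = f := by
    rw [LinearEquiv.symm_apply_eq]; rfl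
  change incl (T ((LinearEquiv.ofInjective incl incl_injective).symm ⟨incl f, ⟨f, rfl⟩⟩)) = _
  rw [this]

variable {E : Type*} [NormedAddCommGroup E] [NormedSpace ℂ E]

lemma Maps.prodOp {S T : E →ₗ.[ℂ] E} {x y z : E} (hT : Maps T x y) (hS : Maps S y z) :
    Maps (prodOp S T) x z := by
  obtain ⟨hx, rfl⟩ := hT
  obtain ⟨hy, rfl⟩ := hS
  exact ⟨⟨hx, hy⟩, rfl⟩

/-- Powers of an operator which acts as `F` on the range of a map `i`. -/
lemma maps_powOp {X : Type*} {T : E →ₗ.[ℂ] E} (i : X → E) (F : X → X)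
    (h : ∀ x, Maps T (i x) (i (F x))) (n : ℕ) (x : X) :
    Maps (powOp T n) (i x) (i (F^[n] x)) := by
  induction n with
  | zero => exact ⟨trivial, rfl⟩
  | succ n ih =>
    rw [Function.iterate_succ_apply']
    exact ih.prodOp (h _)

lemma Maps.smul {T : E →ₗ.[ℂ] E} {x y : E} (h : Maps T x y) (c : ℂ) :
    Maps T (c • x) (c • y) := by
  obtain ⟨hx, rfl⟩ := h
  exact ⟨T.domain.smul_mem c hx, T.map_smul c ⟨x, hx⟩⟩

lemma Maps.add {T : E →ₗ.[ℂ] E} {x y x' y' : E} (h : Maps T x y) (h' : Maps T x' y') :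
    Maps T (x + x') (y + y') := by
  obtain ⟨hx, rfl⟩ := h
  obtain ⟨hx', rfl⟩ := h'
  exact ⟨T.domain.add_mem hx hx', T.map_add ⟨x, hx⟩ ⟨x', hx'⟩⟩

lemma Maps.zero (T : E →ₗ.[ℂ] E) : Maps T 0 0 := ⟨T.domain.zero_mem, T.map_zero⟩

lemma IntertwinesOn.of_span {s : Set E} {S M N : E →ₗ.[ℂ] E}
    (h : ∀ f ∈ s, ∃ g, Maps (Landau.prodOp S M) f g ∧ Maps (Landau.prodOp N S) f g) :
    IntertwinesOn (Submodule.span ℂ s) S M N := by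
  intro f hf
  induction hf using Submodule.span_induction with
  | mem f hf => exact h f hf
  | zero => exact ⟨0, Maps.zero _, Maps.zero _⟩
  | add f f' _ _ hf hf' =>
    obtain ⟨g, h1, h2⟩ := hf
    obtain ⟨g', h1', h2'⟩ := hf'
    exact ⟨g + g', h1.add h1', h2.add h2'⟩
  | smul c f _ hf =>
    obtain ⟨g, h1, h2⟩ := hf
    exact ⟨c • g, h1.smul c, h2.smul c⟩

lemma dense_range_incl : Dense (LinearMap.range incl : Set Hil) := by
  have := SchwartzMap.denseRange_toLpCLM (E := ℝ × ℝ) (F := ℂ) (p := 2)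
    (μ := (volume : Measure (ℝ × ℝ))) (by simp)
  exact this

/-- `S` is a formal adjoint of `T` for the pairing `∫ conj u v` of Schwartz functions. -/
def IsAdj (T S : Sch →ₗ[ℂ] Sch) : Prop :=
  ∀ u v : Sch, ∫ p, conj (S u p) * v p = ∫ p, conj (u p) * T v p

lemma inner_incl (u v : Sch) : inner ℂ (incl u) (incl v) = ∫ p, conj (u p) * v p := by
  have := SchwartzMap.inner_toL2_toL2_eq u v (volume : Measure (ℝ × ℝ))
  refine this.trans ?_
  simp [mul_comm]

/-- The adjoint is tested only against the domain of `O`, which consists of Schwartz functions, and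
density makes its value unique. A general `O` is allowed so that products are covered too. -/
lemma IsAdj.maps {T S : Sch →ₗ[ℂ] Sch} (h : IsAdj T S) {O : Hil →ₗ.[ℂ] Hil}
    (hO : O.domain = LinearMap.range incl) (hT : ∀ f, Maps O (incl f) (incl (T f))) (f : Sch) :
    Maps O† (incl f) (incl (S f)) := by
  have hd : Dense (O.domain : Set Hil) := by rw [hO]; exact dense_range_incl
  have key : ∀ x : O.domain, inner ℂ (incl (S f)) (x : Hil) = inner ℂ (incl f) (O x) := by
    rintro ⟨x, hx⟩
    obtain ⟨v, rfl⟩ : x ∈ LinearMap.range incl := hO ▸ hx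
    obtain ⟨_, hv⟩ := hT v
    rw [hv, inner_incl, inner_incl, h]
  exact ⟨LinearPMap.mem_adjoint_domain_of_exists _ ⟨_, key⟩, LinearPMap.adjoint_apply_eq hd _ key⟩

lemma IsAdj.maps_onL2 {T S : Sch →ₗ[ℂ] Sch} (h : IsAdj T S) (f : Sch) :
    Maps (onL2 T)† (incl f) (incl (S f)) :=
  h.maps rfl (Landau.maps_onL2 T) f

lemma prodOp_onL2_domain (S T : Sch →ₗ[ℂ] Sch) :
    (prodOp (onL2 S) (onL2 T)).domain = LinearMap.range incl := by
  ext x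
  constructor
  · rintro ⟨h, _⟩; exact h
  · rintro ⟨f, rfl⟩
    exact ((Landau.maps_onL2 T f).prodOp (Landau.maps_onL2 S (T f))).1

lemma maps_prodOp_onL2 (S T : Sch →ₗ[ℂ] Sch) (f : Sch) :
    Maps (prodOp (onL2 S) (onL2 T)) (incl f) (incl (S (T f))) :=
  (maps_onL2 T f).prodOp (maps_onL2 S (T f))

/-- The adjoint of a product may properly extend the product of the adjoints, so it is computed
directly from the composite on Schwartz functions. -/
lemma IsAdj.maps_prodOp {T S T' S' : Sch →ₗ[ℂ] Sch} (h : IsAdj T S) (h' : IsAdj T' S') (f : Sch) :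
    Maps (Landau.prodOp (onL2 T) (onL2 T'))† (incl f) (incl (S' (S f))) := by
  exact IsAdj.maps (T := T ∘ₗ T') (S := S' ∘ₗ S) (fun _ _ => (h' _ _).trans (h _ _))
    (prodOp_onL2_domain T T') (maps_prodOp_onL2 T T') f

lemma IsAdj.smul {T S : Sch →ₗ[ℂ] Sch} (h : IsAdj T S) (c : ℂ) : IsAdj (c • T) (conj c • S) := by
  intro u v
  have h1 : ∀ p, conj ((conj c • S) u p) * v p = c * (conj (S u p) * v p) := fun p => by
    simp [mul_assoc]
  have h2 : ∀ p, conj (u p) * (c • T) v p = c * (conj (u p) * T v p) := fun p => by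
    simp; ring
  simp_rw [h1, h2, integral_const_mul, h u v]

lemma integrable_conj_mul (u v : Sch) : Integrable (fun p => conj (u p) * v p) := by
  have := (u.memLp 2 (volume : Measure (ℝ × ℝ))).star.integrable_mul
    (v.memLp 2 (volume : Measure (ℝ × ℝ)))
  exact this

lemma IsAdj.add {T S T' S' : Sch →ₗ[ℂ] Sch} (h : IsAdj T S) (h' : IsAdj T' S') :
    IsAdj (T + T') (S + S') := by
  intro u v
  have h1 : ∀ p, conj ((S + S') u p) * v p = conj (S u p) * v p + conj (S' u p) * v p :=
    fun p => by simp [add_mul]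
  have h2 : ∀ p, conj (u p) * (T + T') v p = conj (u p) * T v p + conj (u p) * T' v p :=
    fun p => by simp [mul_add]
  simp_rw [h1, h2]
  rw [integral_add (integrable_conj_mul _ _) (integrable_conj_mul _ _),
    integral_add (integrable_conj_mul _ _) (integrable_conj_mul _ _), h, h']

lemma IsAdj.comp {T S T' S' : Sch →ₗ[ℂ] Sch} (h : IsAdj T S) (h' : IsAdj T' S') :
    IsAdj (T ∘ₗ T') (S' ∘ₗ S) := fun _ _ => (h' _ _).trans (h _ _)

end Lifts

/-! ### First order differential operators with affine coefficients -/

/-- `∂_x` on Schwartz functions. -/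
def dX : Sch →ₗ[ℂ] Sch := (lineDerivOpCLM ℂ Sch ((1, 0) : ℝ × ℝ)).toLinearMap

/-- `∂_y` on Schwartz functions. -/
def dY : Sch →ₗ[ℂ] Sch := (lineDerivOpCLM ℂ Sch ((0, 1) : ℝ × ℝ)).toLinearMap

/-- Multiplication of Schwartz functions by `a x + b y`. -/
def mLin (a b : ℂ) : Sch →ₗ[ℂ] Sch := mulS fun p => a * p.1 + b * p.2

/-- The operator `a ∂_x + b ∂_y + c x + d y` on Schwartz functions. -/
def fstOrd (a b c d : ℂ) : Sch →ₗ[ℂ] Sch := a • dX + b • dY + mLin c d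

lemma mLin_apply (a b : ℂ) (f : Sch) (p : ℝ × ℝ) : mLin a b f p = (a * p.1 + b * p.2) * f p :=
  mulS_affine_apply a b f p

lemma dX_apply (f : Sch) (p : ℝ × ℝ) : dX f p = fderiv ℝ f p (1, 0) :=
  SchwartzMap.lineDerivOp_apply_eq_fderiv _ _ _

lemma dY_apply (f : Sch) (p : ℝ × ℝ) : dY f p = fderiv ℝ f p (0, 1) :=
  SchwartzMap.lineDerivOp_apply_eq_fderiv _ _ _

lemma fstOrd_apply (a b c d : ℂ) (f : Sch) (p : ℝ × ℝ) :
    fstOrd a b c d f p = a * dX f p + b * dY f p + (c * p.1 + d * p.2) * f p := by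
  simp [fstOrd, mLin_apply]

lemma dX_dY (f : Sch) : dX (dY f) = dY (dX f) := by
  ext p
  have hs : ContDiffAt ℝ 2 f p := (f.smooth 2).contDiffAt
  have hd : DifferentiableAt ℝ (fderiv ℝ f) p :=
    (hs.fderiv_right (m := 1) (by norm_num)).differentiableAt (by norm_num)
  have h1 : ⇑(dX f) = fun q => fderiv ℝ f q (1, 0) := funext (dX_apply f)
  have h2 : ⇑(dY f) = fun q => fderiv ℝ f q (0, 1) := funext (dY_apply f)
  rw [dX_apply, dY_apply, h1, h2, fderiv_clm_apply hd (differentiableAt_const _),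
    fderiv_clm_apply hd (differentiableAt_const _)]
  simpa using (hs.isSymmSndFDerivAt (by simp)) (1, 0) (0, 1)

lemma hasFDerivAt_affine (a b : ℂ) (p : ℝ × ℝ) :
    HasFDerivAt (fun p : ℝ × ℝ => a * p.1 + b * p.2)
      (a • (ofRealCLM.comp (ContinuousLinearMap.fst ℝ ℝ ℝ)) +
        b • (ofRealCLM.comp (ContinuousLinearMap.snd ℝ ℝ ℝ))) p := by
  have h1 := (ofRealCLM.comp (ContinuousLinearMap.fst ℝ ℝ ℝ)).hasFDerivAt (x := p)
  have h2 := (ofRealCLM.comp (ContinuousLinearMap.snd ℝ ℝ ℝ)).hasFDerivAt (x := p)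
  exact (h1.const_mul a).add (h2.const_mul b)

lemma fderiv_mLin (a b : ℂ) (f : Sch) (p v : ℝ × ℝ) :
    fderiv ℝ (mLin a b f) p v =
      (a * p.1 + b * p.2) * fderiv ℝ f p v + (a * v.1 + b * v.2) * f p := by
  have h : ⇑(mLin a b f) = fun p : ℝ × ℝ => (a * p.1 + b * p.2) * f p :=
    funext (mLin_apply a b f)
  have h' := ((hasFDerivAt_affine a b p).mul
    f.differentiableAt.hasFDerivAt).congr_of_eventuallyEq (.of_eq h)
  rw [h'.fderiv]
  simp; ring

lemma dX_mLin (a b : ℂ) (f : Sch) : dX (mLin a b f) = mLin a b (dX f) + a • f := by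
  ext p
  simp [dX_apply, mLin_apply, fderiv_mLin]

lemma dY_mLin (a b : ℂ) (f : Sch) : dY (mLin a b f) = mLin a b (dY f) + b • f := by
  ext p
  simp [dY_apply, mLin_apply, fderiv_mLin]

lemma mLin_comm (a b a' b' : ℂ) (f : Sch) : mLin a b (mLin a' b' f) = mLin a' b' (mLin a b f) := by
  ext p
  simp only [mLin_apply]; ring

/-- The derivative coefficients are constant, so second order terms cancel and only the derivatives
of the linear coefficients survive. -/
lemma fstOrd_comm (a b c d a' b' c' d' : ℂ) (f : Sch) :
    fstOrd a b c d (fstOrd a' b' c' d' f) - fstOrd a' b' c' d' (fstOrd a b c d f) =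
      (a * c' - a' * c + (b * d' - b' * d)) • f := by
  simp only [fstOrd, LinearMap.add_apply, LinearMap.smul_apply, map_add, map_smul, dX_mLin,
    dY_mLin, dX_dY, mLin_comm c' d' c d, smul_add]
  module

lemma smul_fstOrd (s a b c d : ℂ) : s • fstOrd a b c d = fstOrd (s * a) (s * b) (s * c) (s * d) := by
  ext f p
  simp [fstOrd_apply]; ring

lemma fstOrd_add (a b c d a' b' c' d' : ℂ) :
    fstOrd a b c d + fstOrd a' b' c' d' = fstOrd (a + a') (b + b') (c + c') (d + d') := by
  ext f p
  simp [fstOrd_apply]; ring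

/-- Integration by parts. -/
lemma isAdj_lineDeriv (m : ℝ × ℝ) :
    IsAdj (lineDerivOpCLM ℂ Sch m).toLinearMap ((-1 : ℂ) • (lineDerivOpCLM ℂ Sch m).toLinearMap) := by
  intro u v
  have := SchwartzMap.integral_bilinear_lineDerivOp_right_eq_neg_left
    (μ := (volume : Measure (ℝ × ℝ))) u v
    ((ContinuousLinearMap.mul ℝ ℂ).comp (conjCLE : ℂ →L[ℝ] ℂ)) m
  simp only [ContinuousLinearMap.comp_apply, ContinuousLinearMap.mul_apply'] at this
  refine Eq.trans ?_ this.symm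
  rw [← integral_neg]
  congr 1; ext p
  simp

lemma isAdj_mLin (a b : ℂ) : IsAdj (mLin a b) (mLin (conj a) (conj b)) := by
  intro u v
  congr 1; ext p
  simp only [mLin_apply]; simp; ring

lemma isAdj_fstOrd (a b c d : ℂ) :
    IsAdj (fstOrd a b c d) (fstOrd (-conj a) (-conj b) (conj c) (conj d)) := by
  have := ((((isAdj_lineDeriv (1, 0)).smul a).add ((isAdj_lineDeriv (0, 1)).smul b)).add
    (isAdj_mLin c d))
  simp only [smul_smul, mul_neg_one] at this
  exact this

/-! ### Normal form of the operators, duality and the ladder algebra -/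

namespace Model

variable (M : Model)

lemma sQ_eq : M.sQ = fstOrd (-I) 0 (-(I * M.k₂)) (1 / 2) := by
  ext f p
  simp only [sQ, LinearMap.sub_apply, _root_.sub_apply, mulS_V₂, fstOrd_apply, V₂]
  change -I * dX f p - _ = _
  ring

lemma sP_eq : M.sP = fstOrd 0 (-I) (-1 / 2) (I * M.k₁) := by
  ext f p
  simp only [sP, LinearMap.add_apply, _root_.add_apply, mulS_V₁, fstOrd_apply, V₁]
  change -I * dY f p + _ = _
  ring

lemma sP'_eq : M.sP' = fstOrd (-I) 0 (-(I * M.k₂)) (-1 / 2) := by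
  ext f p
  simp only [sP', LinearMap.add_apply, _root_.add_apply, mulS_W₂, fstOrd_apply, W₂]
  change -I * dX f p + _ = _
  ring

lemma sQ'_eq : M.sQ' = fstOrd 0 (-I) (1 / 2) (I * M.k₁) := by
  ext f p
  simp only [sQ', LinearMap.sub_apply, _root_.sub_apply, mulS_W₁, fstOrd_apply, W₁]
  change -I * dY f p - _ = _
  ring

lemma sA_eq : M.sA = fstOrd (-I * M.α) M.α (-I * M.α * (1 / 2 + M.k₂))
    (M.α * (1 / 2 - M.k₁)) := by
  rw [sA, sQ_eq, sP_eq, smul_fstOrd, fstOrd_add, smul_fstOrd]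
  congr 1 <;> ring_nf <;> simp only [I_sq] <;> ring

lemma sB_eq : M.sB = fstOrd (-I * M.γ) (-M.γ) (I * M.γ * (1 / 2 - M.k₂))
    (M.γ * (1 / 2 + M.k₁)) := by
  rw [sB, sQ_eq, sP_eq, sub_eq_add_neg, ← neg_smul, smul_fstOrd, fstOrd_add, smul_fstOrd]
  congr 1 <;> ring_nf <;> simp only [I_sq] <;> ring

lemma sA'_eq : M.sA' = fstOrd M.α' (-I * M.α') (M.α' * (1 / 2 + M.k₂))
    (-I * M.α' * (1 / 2 - M.k₁)) := by
  rw [sA', sQ'_eq, sP'_eq, smul_fstOrd, fstOrd_add, smul_fstOrd]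
  congr 1 <;> ring_nf <;> simp only [I_sq] <;> ring

lemma sB'_eq : M.sB' = fstOrd (-M.γ') (-I * M.γ') (M.γ' * (1 / 2 - M.k₂))
    (I * M.γ' * (1 / 2 + M.k₁)) := by
  rw [sB', sQ'_eq, sP'_eq, sub_eq_add_neg, ← neg_smul, smul_fstOrd, fstOrd_add, smul_fstOrd]
  congr 1 <;> ring_nf <;> simp only [I_sq] <;> ring

/-- The model whose operators `B, B'` and vacuum are the formal adjoints of `A, A'` and the
vacuum `Ψ₀₀`. -/
def dual : Model where
  k₁ := -M.k₁
  k₂ := -M.k₂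
  α := conj M.γ
  γ := conj M.α
  α' := conj M.γ'
  γ' := conj M.α'
  Nφ := M.NΨ
  NΨ := M.Nφ

lemma dual_dual : M.dual.dual = M := by simp [dual]

lemma vacφ_dual : M.dual.vacφ = M.vacΨ := by
  funext p; simp [dual, vacφ, vacΨ, sub_eq_add_neg]

lemma Tφ_dual : M.dual.Tφ = M.TΨ := by
  simp only [Tφ, TΨ, dual]; congr! 5; ring

lemma TφInv_dual : M.dual.TφInv = M.TΨInv := by
  simp only [TφInv, TΨInv, dual]; congr! 5; ring

lemma SΨ_dual : M.dual.SΨ = M.Sφ := by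
  simp only [Sφ, SΨ, dual]; congr! 5; ring

lemma conj_two : conj (2 : ℂ) = 2 := map_ofNat _ 2

/-- Taking adjoints conjugates all coefficients and changes the sign of the derivative terms; in
normal form this is the change of parameters made by `dual`, with creation and annihilation
exchanged. -/
lemma isAdj_sB : IsAdj M.sB M.dual.sA := by
  have := isAdj_fstOrd (-I * M.γ) (-M.γ) (I * M.γ * (1 / 2 - M.k₂)) (M.γ * (1 / 2 + M.k₁))
  rw [← sB_eq] at this
  convert this using 1
  rw [sA_eq]
  simp [dual, sub_eq_add_neg, conj_two]

lemma isAdj_sA : IsAdj M.sA M.dual.sB := by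
  have := isAdj_fstOrd (-I * M.α) M.α (-I * M.α * (1 / 2 + M.k₂)) (M.α * (1 / 2 - M.k₁))
  rw [← sA_eq] at this
  convert this using 1
  rw [sB_eq]
  simp [dual, sub_eq_add_neg, conj_two]

lemma isAdj_sB' : IsAdj M.sB' M.dual.sA' := by
  have := isAdj_fstOrd (-M.γ') (-I * M.γ') (M.γ' * (1 / 2 - M.k₂)) (I * M.γ' * (1 / 2 + M.k₁))
  rw [← sB'_eq] at this
  convert this using 1
  rw [sA'_eq]
  simp [dual, sub_eq_add_neg, conj_two]

lemma isAdj_sA' : IsAdj M.sA' M.dual.sB' := by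
  have := isAdj_fstOrd M.α' (-I * M.α') (M.α' * (1 / 2 + M.k₂)) (-I * M.α' * (1 / 2 - M.k₁))
  rw [← sA'_eq] at this
  convert this using 1
  rw [sB'_eq]
  simp [dual, sub_eq_add_neg, conj_two]

/-! ### Commutation relations -/

lemma sA_sB (h : M.α * M.γ = 1 / 2) (f : Sch) : M.sA (M.sB f) - M.sB (M.sA f) = f := by
  rw [sA_eq, sB_eq, fstOrd_comm]
  convert one_smul ℂ f
  linear_combination 2 * h - 2 * M.α * M.γ * (1 / 2) * I_sq

lemma sA'_sB' (h : M.α' * M.γ' = 1 / 2) (f : Sch) :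
    M.sA' (M.sB' f) - M.sB' (M.sA' f) = f := by
  rw [sA'_eq, sB'_eq, fstOrd_comm]
  convert one_smul ℂ f
  linear_combination 2 * h - 2 * M.α' * M.γ' * (1 / 2) * I_sq

lemma sA_sA' (f : Sch) : M.sA (M.sA' f) = M.sA' (M.sA f) := by
  rw [← sub_eq_zero, sA_eq, sA'_eq, fstOrd_comm]
  convert zero_smul ℂ f
  ring

lemma sA_sB' (f : Sch) : M.sA (M.sB' f) = M.sB' (M.sA f) := by
  rw [← sub_eq_zero, sA_eq, sB'_eq, fstOrd_comm]
  convert zero_smul ℂ f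
  ring

lemma sB_sA' (f : Sch) : M.sB (M.sA' f) = M.sA' (M.sB f) := by
  rw [← sub_eq_zero, sB_eq, sA'_eq, fstOrd_comm]
  convert zero_smul ℂ f
  ring

lemma sB_sB' (f : Sch) : M.sB (M.sB' f) = M.sB' (M.sB f) := by
  rw [← sub_eq_zero, sB_eq, sB'_eq, fstOrd_comm]
  convert zero_smul ℂ f
  ring

lemma sQ_sP (f : Sch) : M.sQ (M.sP f) - M.sP (M.sQ f) = I • f := by
  rw [sQ_eq, sP_eq, fstOrd_comm]
  congr 1; ring

lemma sQ'_sP' (f : Sch) : M.sQ' (M.sP' f) - M.sP' (M.sQ' f) = I • f := by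
  rw [sQ'_eq, sP'_eq, fstOrd_comm]
  congr 1; ring

/-- `(Q - iP)(Q + iP) = Q² + P² + i[Q, P]`, and `[Q, P] = i` produces the zero-point energy. -/
lemma sH_eq (h : M.α * M.γ = 1 / 2) (f : Sch) : M.sH f = M.sB (M.sA f) + (1 / 2 : ℂ) • f := by
  have hc := M.sQ_sP f
  ext p
  have hp := congrArg (fun g : Sch => g p) hc
  simp only [sH, sA, sB, LinearMap.add_apply, LinearMap.sub_apply, LinearMap.smul_apply,
    LinearMap.comp_apply, map_add, map_smul, _root_.add_apply, _root_.sub_apply,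
    _root_.smul_apply, smul_eq_mul] at hp ⊢
  generalize M.sQ (M.sQ f) p = a at *
  generalize M.sP (M.sP f) p = b at *
  generalize M.sQ (M.sP f) p = c at *
  generalize M.sP (M.sQ f) p = d at *
  linear_combination (-(a + b + I * c - I * d)) * h + (-1 / 2) * I * hp +
    (M.α * M.γ * b - f p / 2) * I_sq

lemma sH'_eq (h : M.α' * M.γ' = 1 / 2) (f : Sch) :
    M.sH' f = M.sB' (M.sA' f) + (1 / 2 : ℂ) • f := by
  have hc := M.sQ'_sP' f
  ext p
  have hp := congrArg (fun g : Sch => g p) hc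
  simp only [sH', sA', sB', LinearMap.add_apply, LinearMap.sub_apply, LinearMap.smul_apply,
    LinearMap.comp_apply, map_add, map_smul, _root_.add_apply, _root_.sub_apply,
    _root_.smul_apply, smul_eq_mul] at hp ⊢
  generalize M.sQ' (M.sQ' f) p = a at *
  generalize M.sP' (M.sP' f) p = b at *
  generalize M.sQ' (M.sP' f) p = c at *
  generalize M.sP' (M.sQ' f) p = d at *
  linear_combination (-(a + b + I * c - I * d)) * h + (-1 / 2) * I * hp +
    (M.α' * M.γ' * b - f p / 2) * I_sq

/-- Multiplication by `x + i y` in terms of the ladder operators. -/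
lemma mLin_z (hγ' : M.γ' ≠ 0) (hα : M.α ≠ 0) (f : Sch) :
    mLin 1 I f = (M.γ')⁻¹ • M.sB' f + (I * (M.α)⁻¹) • M.sA f := by
  ext p
  simp only [sA_eq, sB'_eq, _root_.add_apply, _root_.smul_apply, fstOrd_apply, mLin_apply,
    smul_eq_mul]
  field_simp
  ring_nf; simp only [I_sq]; ring

/-- Multiplication by `x - i y` in terms of the ladder operators. -/
lemma mLin_zbar (hα' : M.α' ≠ 0) (hγ : M.γ ≠ 0) (f : Sch) :
    mLin 1 (-I) f = (M.α')⁻¹ • M.sA' f - (I * (M.γ)⁻¹) • M.sB f := by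
  ext p
  simp only [sA'_eq, sB_eq, _root_.sub_apply, _root_.smul_apply, fstOrd_apply,
    mLin_apply, smul_eq_mul]
  field_simp
  ring_nf; simp only [I_sq]; ring

end Model

/-! ### Gaussians as Schwartz functions -/

lemma norm_sq_le_add_sq (p : ℝ × ℝ) : ‖p‖ ^ 2 ≤ p.1 ^ 2 + p.2 ^ 2 := by
  rw [Prod.norm_def]
  rcases max_choice ‖p.1‖ ‖p.2‖ with h | h <;> rw [h, Real.norm_eq_abs, sq_abs] <;>
    nlinarith [sq_nonneg p.1, sq_nonneg p.2]

/-- The power is at most `m! exp (1 + t)`; completing the square then bounds the exponent `1 + t - a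
t²`. -/
lemma pow_mul_exp_neg_sq_le {a : ℝ} (ha : 0 < a) (m : ℕ) {t : ℝ} (ht : 0 ≤ t) :
    (1 + t) ^ m * Real.exp (-(a * t ^ 2)) ≤ m.factorial * Real.exp (1 + 1 / (4 * a)) := by
  have h1 : (1 + t) ^ m ≤ m.factorial * Real.exp (1 + t) := by
    have := Real.pow_div_factorial_le_exp (1 + t) (by positivity) m
    rwa [div_le_iff₀' (by positivity)] at this
  have h2 : 1 + t - a * t ^ 2 ≤ 1 + 1 / (4 * a) := by
    have : 1 / (4 * a) - t + a * t ^ 2 = (2 * a * t - 1) ^ 2 / (4 * a) := by field_simp; ring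
    have : 0 ≤ 1 / (4 * a) - t + a * t ^ 2 := this ▸ by positivity
    linarith
  calc _ ≤ m.factorial * Real.exp (1 + t) * Real.exp (-(a * t ^ 2)) := by gcongr
    _ = m.factorial * Real.exp (1 + t - a * t ^ 2) := by
      rw [mul_assoc, ← Real.exp_add, sub_eq_add_neg]
    _ ≤ _ := by gcongr

/-- The quadratic form `-(a x² + b y²)`. -/
def quad (a b : ℝ) (p : ℝ × ℝ) : ℝ := -(a * p.1 ^ 2 + b * p.2 ^ 2)

lemma quad_le {a b : ℝ} (p : ℝ × ℝ) (ha : 0 < a) (hb : 0 < b) :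
    quad a b p ≤ -(min a b * ‖p‖ ^ 2) := by
  have := norm_sq_le_add_sq p
  have h1 := min_le_left a b
  have h2 := min_le_right a b
  have h3 : 0 < min a b := lt_min ha hb
  unfold quad
  nlinarith [sq_nonneg p.1, sq_nonneg p.2]

lemma hasTemperateGrowth_quad (a b : ℝ) : Function.HasTemperateGrowth (quad a b) := by
  have h1 : Function.HasTemperateGrowth (fun p : ℝ × ℝ => p.1) :=
    (ContinuousLinearMap.fst ℝ ℝ ℝ).hasTemperateGrowth
  have h2 : Function.HasTemperateGrowth (fun p : ℝ × ℝ => p.2) :=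
    (ContinuousLinearMap.snd ℝ ℝ ℝ).hasTemperateGrowth
  exact (((Function.HasTemperateGrowth.const a).mul (h1.pow 2)).add
    ((Function.HasTemperateGrowth.const b).mul (h2.pow 2))).neg

/-- All derivatives of `exp` are `exp`, and those of the quadratic form grow polynomially, so the
derivatives of the composite are bounded by a polynomial times the Gaussian itself. -/
lemma gaussian_decay {a b : ℝ} (ha : 0 < a) (hb : 0 < b) (k n : ℕ) :
    ∃ C : ℝ, ∀ p, ‖p‖ ^ k *
      ‖iteratedFDeriv ℝ n (fun p => (Real.exp (quad a b p) : ℂ)) p‖ ≤ C := by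
  obtain ⟨j, C, hC, h⟩ := (hasTemperateGrowth_quad a b).norm_iteratedFDeriv_le_uniform n
  have hm : 0 < min a b := lt_min ha hb
  refine ⟨n.factorial * (C + 1) ^ n * ((k + j * n).factorial *
    Real.exp (1 + 1 / (4 * min a b))), fun p => ?_⟩
  have h1 : ‖iteratedFDeriv ℝ n (fun p => (Real.exp (quad a b p) : ℂ)) p‖ =
      ‖iteratedFDeriv ℝ n (Real.exp ∘ quad a b) p‖ :=
    ofRealLI.norm_iteratedFDeriv_comp_left
      ((Real.contDiff_exp.comp (hasTemperateGrowth_quad a b).1).contDiffAt) (mod_cast le_top)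
  -- The bound for the composite needs the `i`-th inner derivative below `D ^ i`. Using `C + 1`
  -- instead of `C` makes `D ≥ 1`, so a bound by `D` suffices for `i ≥ 1`.
  have hone : (1 : ℝ) ≤ (C + 1) * (1 + ‖p‖) ^ j := by
    have := one_le_pow₀ (n := j) (show (1 : ℝ) ≤ 1 + ‖p‖ by simp)
    nlinarith
  have h2 : ‖iteratedFDeriv ℝ n (Real.exp ∘ quad a b) p‖ ≤
      n.factorial * Real.exp (quad a b p) * ((C + 1) * (1 + ‖p‖) ^ j) ^ n := by
    refine norm_iteratedFDeriv_comp_le (N := (⊤ : ℕ∞)) Real.contDiff_exp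
      (hasTemperateGrowth_quad a b).1 (mod_cast le_top) p (fun i _ => ?_) (fun i hi hin => ?_)
    · rw [norm_iteratedFDeriv_eq_norm_iteratedDeriv, iteratedDeriv_eq_iterate, Real.iter_deriv_exp,
        Real.norm_eq_abs, Real.abs_exp]
    · calc _ ≤ C * (1 + ‖p‖) ^ j := h i hin p
        _ ≤ (C + 1) * (1 + ‖p‖) ^ j := by gcongr; linarith
        _ ≤ _ := le_self_pow₀ hone (by lia)
  rw [h1]
  calc ‖p‖ ^ k * ‖iteratedFDeriv ℝ n (Real.exp ∘ quad a b) p‖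
      ≤ (1 + ‖p‖) ^ k * (n.factorial * Real.exp (-(min a b * ‖p‖ ^ 2)) *
        ((C + 1) * (1 + ‖p‖) ^ j) ^ n) := by
        gcongr
        · linarith
        · refine h2.trans ?_
          gcongr
          exact quad_le p ha hb
    _ = n.factorial * (C + 1) ^ n *
        ((1 + ‖p‖) ^ (k + j * n) * Real.exp (-(min a b * ‖p‖ ^ 2))) := by
        rw [mul_pow, ← pow_mul, pow_add]; ring
    _ ≤ _ := by
        exact mul_le_mul_of_nonneg_left (pow_mul_exp_neg_sq_le hm _ (norm_nonneg p))
          (by positivity)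

/-- The Gaussian `exp (-(a x² + b y²))` as a Schwartz function. -/
def gaussian {a b : ℝ} (ha : 0 < a) (hb : 0 < b) : Sch where
  toFun p := (Real.exp (quad a b p) : ℂ)
  smooth' := ofRealCLM.contDiff.comp (Real.contDiff_exp.comp (hasTemperateGrowth_quad a b).1)
  decay' := gaussian_decay ha hb

lemma gaussian_apply {a b : ℝ} (ha : 0 < a) (hb : 0 < b) (p : ℝ × ℝ) :
    gaussian ha hb p = (Real.exp (quad a b p) : ℂ) := rfl

/-! ### Products with exponentials of quadratic forms -/

lemma hasFDerivAt_exp_quad (a b : ℝ) (p : ℝ × ℝ) :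
    HasFDerivAt (fun p => (Real.exp (quad a b p) : ℂ))
      ((Real.exp (quad a b p) : ℂ) • ((-(2 * a * p.1) : ℂ) •
        (ofRealCLM.comp (ContinuousLinearMap.fst ℝ ℝ ℝ)) +
        (-(2 * b * p.2) : ℂ) • (ofRealCLM.comp (ContinuousLinearMap.snd ℝ ℝ ℝ)))) p := by
  have h1 := (ContinuousLinearMap.fst ℝ ℝ ℝ).hasFDerivAt (x := p)
  have h2 := (ContinuousLinearMap.snd ℝ ℝ ℝ).hasFDerivAt (x := p)
  have h3 : HasFDerivAt (quad a b) _ p := (((h1.pow 2).const_mul a).add ((h2.pow 2).const_mul b)).neg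
  have h4 := ofRealCLM.hasFDerivAt.comp p h3.exp
  refine h4.congr_fderiv ?_
  ext <;> simp <;> ring

/-- Conjugating a first order operator by an exponential of a quadratic form. -/
lemma fstOrd_of_eq_exp_quad_mul {k₁ k₂ : ℝ} {c : ℂ} {f g : Sch}
    (h : ∀ p, g p = c * Real.exp (quad k₁ k₂ p) * f p) (s t u v : ℂ) (p : ℝ × ℝ) :
    fstOrd s t u v g p = c * Real.exp (quad k₁ k₂ p) *
      fstOrd s t (u - 2 * k₁ * s) (v - 2 * k₂ * t) f p := by
  have h' := (((hasFDerivAt_exp_quad k₁ k₂ p).const_mul c).mul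
    f.differentiableAt.hasFDerivAt).congr_of_eventuallyEq (f₁ := g) (.of_eq (funext h))
  simp only [fstOrd_apply, dX_apply, dY_apply, h'.fderiv]
  simp [h]; ring

lemma fstOrd_gaussian {a b : ℝ} (ha : 0 < a) (hb : 0 < b) (s t u v : ℂ) (p : ℝ × ℝ) :
    fstOrd s t u v (gaussian ha hb) p =
      ((u - 2 * a * s) * p.1 + (v - 2 * b * t) * p.2) * gaussian ha hb p := by
  have h' := (hasFDerivAt_exp_quad a b p).congr_of_eventuallyEq (f₁ := gaussian ha hb)
    (.of_eq (funext (gaussian_apply ha hb)))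
  simp only [fstOrd_apply, dX_apply, dY_apply, h'.fderiv]
  simp [gaussian_apply]; ring

/-! ### Ladder operators -/

section Ladder

variable {R V : Type*} [CommRing R] [AddCommGroup V] [Module R V]

/-- The action of an annihilation operator on the states created from its vacuum. -/
lemma annihilation_iterate {A B : V →ₗ[R] V} (h : ∀ f, A (B f) - B (A f) = f) {v : V}
    (hv : A v = 0) (n : ℕ) : A (B^[n + 1] v) = ((n + 1 : ℕ) : R) • B^[n] v := by
  induction n with
  | zero => simpa [hv] using h v
  | succ n ih =>
    have h' := eq_add_of_sub_eq (h (B^[n + 1] v))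
    rw [Function.iterate_succ_apply', h', ih, map_smul, ← Function.iterate_succ_apply' B n v]
    push_cast; module

lemma map_iterate_comm {A B : V →ₗ[R] V} (h : ∀ f, A (B f) = B (A f)) (n : ℕ) (f : V) :
    A (B^[n] f) = B^[n] (A f) :=
  Function.Commute.iterate_right (f := A) (g := B) h n f

end Ladder

/-! ### Admissible models, their states and biorthogonality -/

namespace Model

variable {M : Model}

/-- The standing assumptions on the parameters. -/
structure IsAdmissible (M : Model) : Prop where
  k₁ : -1 / 2 < M.k₁ ∧ M.k₁ < 1 / 2
  k₂ : -1 / 2 < M.k₂ ∧ M.k₂ < 1 / 2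
  αγ : M.α * M.γ = 1 / 2
  αγ' : M.α' * M.γ' = 1 / 2

namespace IsAdmissible

lemma dual (h : M.IsAdmissible) : M.dual.IsAdmissible where
  k₁ := by simp only [Model.dual]; constructor <;> linarith [h.k₁.1, h.k₁.2]
  k₂ := by simp only [Model.dual]; constructor <;> linarith [h.k₂.1, h.k₂.2]
  αγ := by
    have := congrArg conj h.αγ
    simpa [Model.dual, mul_comm, conj_two] using this
  αγ' := by
    have := congrArg conj h.αγ'
    simpa [Model.dual, mul_comm, conj_two] using this

lemma sll : Landau.sll.IsAdmissible := by
  have : ((1 / √2 : ℝ) : ℂ) * ((1 / √2 : ℝ) : ℂ) = 1 / 2 := by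
    rw [← ofReal_mul, div_mul_div_comm, Real.mul_self_sqrt (by norm_num)]; norm_num
  constructor <;> simp only [Landau.sll] <;> first | exact this | norm_num

lemma α_ne (h : M.IsAdmissible) : M.α ≠ 0 := fun h0 => by simpa [h0] using h.αγ
lemma γ_ne (h : M.IsAdmissible) : M.γ ≠ 0 := fun h0 => by simpa [h0] using h.αγ
lemma α'_ne (h : M.IsAdmissible) : M.α' ≠ 0 := fun h0 => by simpa [h0] using h.αγ'
lemma γ'_ne (h : M.IsAdmissible) : M.γ' ≠ 0 := fun h0 => by simpa [h0] using h.αγ'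

lemma coeff_pos (h : M.IsAdmissible) : 0 < (1 + 2 * M.k₂) / 4 ∧ 0 < (1 - 2 * M.k₁) / 4 := by
  constructor <;> linarith [h.k₁.2, h.k₂.1]

end IsAdmissible

open Classical in
variable (M) in
/-- The vacuum `φ₀₀` as a Schwartz function. -/
def vac : Sch :=
  if h : 0 < (1 + 2 * M.k₂) / 4 ∧ 0 < (1 - 2 * M.k₁) / 4 then M.Nφ • gaussian h.1 h.2 else 0

lemma vac_eq (h : M.IsAdmissible) : M.vac = M.Nφ • gaussian h.coeff_pos.1 h.coeff_pos.2 :=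
  dif_pos h.coeff_pos

lemma vac_apply (h : M.IsAdmissible) (p : ℝ × ℝ) : M.vac p = M.vacφ p := by
  rw [vac_eq h, _root_.smul_apply, gaussian_apply, smul_eq_mul, vacφ]
  congr 3
  simp only [quad]; ring

/-- The two conditions make the linear term cancel the logarithmic derivative of the Gaussian. -/
lemma fstOrd_vac (h : M.IsAdmissible) {s t u v : ℂ} (h1 : u = (1 / 2 + M.k₂) * s)
    (h2 : v = (1 / 2 - M.k₁) * t) : fstOrd s t u v M.vac = 0 := by
  rw [vac_eq h, map_smul]
  ext p
  rw [_root_.smul_apply, fstOrd_gaussian, h1, h2]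
  push_cast
  refine Eq.trans (b := 0) ?_ rfl
  rw [smul_eq_mul]
  ring

lemma sA_vac (h : M.IsAdmissible) : M.sA M.vac = 0 := by
  rw [sA_eq]; exact fstOrd_vac h (by ring) (by ring)

lemma sA'_vac (h : M.IsAdmissible) : M.sA' M.vac = 0 := by
  rw [sA'_eq]; exact fstOrd_vac h (by ring) (by ring)

variable (M) in
/-- The vector `B'ⁿ Bˡ φ₀₀`. -/
def state (n l : ℕ) : Sch := M.sB'^[n] (M.sB^[l] M.vac)

lemma state_succ_left (n l : ℕ) : M.state (n + 1) l = M.sB' (M.state n l) :=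
  Function.iterate_succ_apply' _ _ _

lemma state_succ_right (n l : ℕ) : M.state n (l + 1) = M.sB (M.state n l) := by
  rw [state, state, map_iterate_comm M.sB_sB', Function.iterate_succ_apply']

lemma sA_state_zero (h : M.IsAdmissible) (n : ℕ) : M.sA (M.state n 0) = 0 := by
  rw [state, map_iterate_comm M.sA_sB', Function.iterate_zero, id, sA_vac h, iterate_map_zero]

lemma sA_state_succ (h : M.IsAdmissible) (n l : ℕ) :
    M.sA (M.state n (l + 1)) = ((l + 1 : ℕ) : ℂ) • M.state n l := by
  rw [state, map_iterate_comm M.sA_sB', annihilation_iterate (M.sA_sB h.αγ) (sA_vac h), state,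
    ← Module.End.coe_pow, map_smul]

lemma sA'_state_zero (h : M.IsAdmissible) (l : ℕ) : M.sA' (M.state 0 l) = 0 := by
  rw [state, Function.iterate_zero, id, map_iterate_comm (fun f => (M.sB_sA' f).symm), sA'_vac h,
    iterate_map_zero]

lemma sA'_state_succ (h : M.IsAdmissible) (n l : ℕ) :
    M.sA' (M.state (n + 1) l) = ((n + 1 : ℕ) : ℂ) • M.state n l :=
  annihilation_iterate (M.sA'_sB' h.αγ') (sA'_state_zero h l) n

lemma sB_sA_state (h : M.IsAdmissible) (n l : ℕ) :
    M.sB (M.sA (M.state n l)) = (l : ℂ) • M.state n l := by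
  cases l with
  | zero => simp [sA_state_zero h]
  | succ l => rw [sA_state_succ h, map_smul, state_succ_right]

lemma sB'_sA'_state (h : M.IsAdmissible) (n l : ℕ) :
    M.sB' (M.sA' (M.state n l)) = (n : ℂ) • M.state n l := by
  cases n with
  | zero => simp [sA'_state_zero h]
  | succ l => rw [sA'_state_succ h, map_smul, state_succ_left]

/-- The pairing `∫ conj u v` of Schwartz functions. -/
def pairing (u v : Sch) : ℂ := ∫ p, conj (u p) * v p

lemma pairing_smul_left (c : ℂ) (u v : Sch) : pairing (c • u) v = conj c * pairing u v := by
  rw [pairing, pairing, ← inner_incl, ← inner_incl, map_smul, inner_smul_left]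

lemma pairing_smul_right (c : ℂ) (u v : Sch) : pairing u (c • v) = c * pairing u v := by
  rw [pairing, pairing, ← inner_incl, ← inner_incl, map_smul, inner_smul_right]

lemma pairing_eq_inner (u v : Sch) : pairing u v = inner ℂ (incl u) (incl v) :=
  (inner_incl u v).symm

lemma _root_.Landau.IsAdj.pairing {T S : Sch →ₗ[ℂ] Sch} (h : IsAdj T S) (u v : Sch) :
    pairing (S u) v = pairing u (T v) := h u v

/-- A creation operator on one side of the pairing is an annihilation operator on the other: it
either lowers the level, with a factor that builds up the factorial, or kills a vacuum. -/
lemma pairing_state_aux (h : M.IsAdmissible) (h0 : pairing M.dual.vac M.vac = 1) (l k : ℕ) :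
    pairing (M.dual.state 0 l) (M.state 0 k) = if l = k then (l.factorial : ℂ) else 0 := by
  induction l generalizing k with
  | zero =>
    cases k with
    | zero => simpa [state] using h0
    | succ k =>
      rw [state_succ_right, ← M.isAdj_sB.pairing, sA_state_zero h.dual, pairing_eq_inner]
      simp
  | succ l ih =>
    rw [state_succ_right, M.isAdj_sA.pairing]
    cases k with
    | zero => rw [sA_state_zero h, pairing_eq_inner]; simp
    | succ k =>
      rw [sA_state_succ h, pairing_smul_right, ih]
      by_cases hlk : l = k
      · subst hlk; simp [Nat.factorial_succ]
      · simp [hlk]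

/-- Biorthogonality of the states of a model and of its dual. -/
lemma pairing_state (h : M.IsAdmissible) (h0 : pairing M.dual.vac M.vac = 1) (n l m k : ℕ) :
    pairing (M.dual.state n l) (M.state m k) =
      if (n, l) = (m, k) then (n.factorial * l.factorial : ℂ) else 0 := by
  induction n generalizing m with
  | zero =>
    cases m with
    | zero => simp [pairing_state_aux h h0]
    | succ m =>
      rw [state_succ_left, ← M.isAdj_sB'.pairing, sA'_state_zero h.dual, pairing_eq_inner]
      simp
  | succ n ih =>
    rw [state_succ_left, M.isAdj_sA'.pairing]
    cases m with
    | zero => rw [sA'_state_zero h, pairing_eq_inner]; simp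
    | succ m =>
      rw [sA'_state_succ h, pairing_smul_right, ih]
      by_cases hlk : n = m ∧ l = k
      · obtain ⟨rfl, rfl⟩ := hlk; simp [Nat.factorial_succ]; ring
      · simp [hlk]

variable (M) in
/-- The vector `φ_{n,l}` as a Schwartz function. -/
def sφ (i : ℕ × ℕ) : Sch := ((√(i.1.factorial * i.2.factorial) : ℝ) : ℂ)⁻¹ • M.state i.1 i.2

variable (M) in
/-- The vector `φ_{n,l}` in `L²(ℝ²)`. -/
def φ (i : ℕ × ℕ) : Hil := incl (M.sφ i)

lemma sqrt_factorial_ne_zero (n l : ℕ) : ((√(n.factorial * l.factorial) : ℝ) : ℂ) ≠ 0 := by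
  have : 0 < √((n.factorial : ℝ) * l.factorial) := Real.sqrt_pos.2 (by positivity)
  exact_mod_cast this.ne'

lemma smul_sφ (n l : ℕ) :
    ((√(n.factorial * l.factorial) : ℝ) : ℂ) • M.sφ (n, l) = M.state n l := by
  rw [sφ, smul_inv_smul₀ (sqrt_factorial_ne_zero n l)]

lemma sφ_zero : M.sφ (0, 0) = M.vac := by simp [sφ, state]

lemma inner_dual_φ (h : M.IsAdmissible) (h0 : pairing M.dual.vac M.vac = 1) (i j : ℕ × ℕ) :
    inner ℂ (M.dual.φ i) (M.φ j) = if i = j then (1 : ℂ) else 0 := by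
  rw [φ, φ, ← pairing_eq_inner, sφ, sφ, pairing_smul_left, pairing_smul_right,
    pairing_state h h0]
  split_ifs with hij
  · obtain rfl : i = j := hij
    have h1 := sqrt_factorial_ne_zero i.1 i.2
    have h2 : ((√(i.1.factorial * i.2.factorial) : ℝ) : ℂ) ^ 2 = i.1.factorial * i.2.factorial := by
      rw [← ofReal_pow, Real.sq_sqrt (by positivity)]; push_cast; rfl
    rw [map_inv₀, conj_ofReal, ← h2]
    field_simp
  · simp

lemma isφFamily (h : M.IsAdmissible) : M.IsφFamily M.φ := by
  refine ⟨?_, fun n l => ?_⟩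
  · rw [φ, sφ_zero]
    refine (SchwartzMap.coeFn_toLp M.vac 2 volume).trans ?_
    exact .of_eq (funext (vac_apply h))
  · rw [φ, φ, ← map_smul, smul_sφ, sφ_zero]
    exact (maps_powOp incl M.sB (maps_onL2 M.sB) l M.vac).prodOp
      (maps_powOp incl M.sB' (maps_onL2 M.sB') n _)

/-- On Schwartz functions `A†` and `A'†` act as the creation operators of the dual model, so their
iterates never leave Schwartz space. -/
lemma isΨFamily_dual (h : M.IsAdmissible) : M.IsΨFamily M.dual.φ := by
  refine ⟨?_, fun n l => ?_⟩
  · rw [← vacφ_dual]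
    exact (isφFamily h.dual).1
  · rw [φ, φ, ← map_smul, smul_sφ, sφ_zero]
    exact (maps_powOp incl M.dual.sB M.isAdj_sA.maps_onL2 l _).prodOp
      (maps_powOp incl M.dual.sB' M.isAdj_sA'.maps_onL2 n _)

lemma memDInf_of_maps {T : Hil →ₗ.[ℂ] Hil} {F : Sch → Sch}
    (h : ∀ f, Maps T (incl f) (incl (F f))) (f : Sch) : MemDInf T (incl f) :=
  fun n => (maps_powOp incl F h n f).1

lemma sB_sA_sφ (h : M.IsAdmissible) (i : ℕ × ℕ) : M.sB (M.sA (M.sφ i)) = (i.2 : ℂ) • M.sφ i := by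
  rw [sφ, map_smul, map_smul, sB_sA_state h, smul_comm]

lemma sB'_sA'_sφ (h : M.IsAdmissible) (i : ℕ × ℕ) :
    M.sB' (M.sA' (M.sφ i)) = (i.1 : ℂ) • M.sφ i := by
  rw [sφ, map_smul, map_smul, sB'_sA'_state h, smul_comm]

/-! ### Comparison with the standard Landau levels -/

variable (M) in
/-- The quotient of the ground states of the model and of the standard Landau levels. -/
def gauge (p : ℝ × ℝ) : ℂ :=
  √(2 * Real.pi) * M.Nφ * Real.exp (-(p.1 ^ 2 * M.k₂ - p.2 ^ 2 * M.k₁) / 2)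

lemma gauge_eq (p : ℝ × ℝ) :
    M.gauge p = √(2 * Real.pi) * M.Nφ * Real.exp (quad (M.k₂ / 2) (-M.k₁ / 2) p) := by
  simp only [gauge, quad]; congr 3; ring

lemma sqrt_two_mul_self : ((√2 : ℝ) : ℂ) * ((√2 : ℝ) : ℂ) = 2 := by
  rw [← ofReal_mul, Real.mul_self_sqrt (by norm_num)]; norm_num

lemma sqrt_two_ne_zero : ((√2 : ℝ) : ℂ) ≠ 0 := fun h => by
  have := sqrt_two_mul_self
  simp [h] at this

lemma sqrt_two_mul_inv : ((√2 : ℝ) : ℂ) * ((1 / √2 : ℝ) : ℂ) = 1 := by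
  rw [ofReal_div, ofReal_one, mul_one_div_cancel sqrt_two_ne_zero]

lemma sll_sB : (√2 : ℂ) • Landau.sll.sB = fstOrd (-I) (-1) (I / 2) (1 / 2) := by
  rw [sB_eq, smul_fstOrd]
  have h := sqrt_two_mul_inv
  simp only [sll, ofReal_zero]
  congr 1
  · linear_combination -I * h
  · linear_combination -h
  · linear_combination I / 2 * h
  · linear_combination 1 / 2 * h

lemma sll_sB' : (√2 : ℂ) • Landau.sll.sB' = fstOrd (-1) (-I) (1 / 2) (I / 2) := by
  rw [sB'_eq, smul_fstOrd]
  have h := sqrt_two_mul_inv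
  simp only [sll, ofReal_zero]
  congr 1
  · linear_combination -h
  · linear_combination -I * h
  · linear_combination 1 / 2 * h
  · linear_combination I / 2 * h

/-- Conjugation by the Gaussian shifts the linear term by exactly its `k`-dependent part; what
remains is the unperturbed operator, up to the ratio of `γ` to `1/√2`. -/
lemma sB_gauge {f g : Sch} (h : ∀ p, g p = M.gauge p * f p) (p : ℝ × ℝ) :
    M.sB g p = M.gauge p * ((√2 * M.γ) • Landau.sll.sB f) p := by
  have h' : ∀ p, g p = √(2 * Real.pi) * M.Nφ * Real.exp (quad (M.k₂ / 2) (-M.k₁ / 2) p) * f p :=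
    fun p => by rw [h, gauge_eq]
  rw [sB_eq, fstOrd_of_eq_exp_quad_mul h', ← gauge_eq, mul_comm (√2 : ℂ) M.γ, ← LinearMap.smul_apply,
    ← smul_smul, sll_sB, smul_fstOrd]
  congr 3
  all_goals push_cast; ring_nf

lemma sB'_gauge {f g : Sch} (h : ∀ p, g p = M.gauge p * f p) (p : ℝ × ℝ) :
    M.sB' g p = M.gauge p * ((√2 * M.γ') • Landau.sll.sB' f) p := by
  have h' : ∀ p, g p = √(2 * Real.pi) * M.Nφ * Real.exp (quad (M.k₂ / 2) (-M.k₁ / 2) p) * f p :=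
    fun p => by rw [h, gauge_eq]
  rw [sB'_eq, fstOrd_of_eq_exp_quad_mul h', ← gauge_eq, mul_comm (√2 : ℂ) M.γ', ← LinearMap.smul_apply,
    ← smul_smul, sll_sB', smul_fstOrd]
  congr 3
  all_goals push_cast; ring_nf

lemma vac_gauge (h : M.IsAdmissible) (p : ℝ × ℝ) :
    M.vac p = M.gauge p * Landau.sll.vac p := by
  have hpi : √(2 * Real.pi) ≠ 0 := (Real.sqrt_pos.2 (by positivity)).ne'
  have h1 : (√(2 * Real.pi) : ℂ) * ((1 / √(2 * Real.pi) : ℝ) : ℂ) = 1 := by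
    rw [← ofReal_mul, mul_one_div_cancel hpi, ofReal_one]
  rw [vac_apply h, vac_apply .sll, vacφ, vacφ, gauge]
  simp only [sll]
  have h2 : Real.exp (-(p.1 ^ 2 / 4) * (1 + 2 * M.k₂) - (p.2 ^ 2 / 4) * (1 - 2 * M.k₁)) =
      Real.exp (-(p.1 ^ 2 * M.k₂ - p.2 ^ 2 * M.k₁) / 2) *
      Real.exp (-(p.1 ^ 2 / 4) * (1 + 2 * 0) - (p.2 ^ 2 / 4) * (1 - 2 * 0)) := by
    rw [← Real.exp_add]; congr 1; ring
  rw [h2, ofReal_mul]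
  linear_combination (-(M.Nφ * Real.exp (-(p.1 ^ 2 * M.k₂ - p.2 ^ 2 * M.k₁) / 2) *
      Real.exp (-(p.1 ^ 2 / 4) * (1 + 2 * 0) - (p.2 ^ 2 / 4) * (1 - 2 * 0)))) * h1

lemma state_gauge (h : M.IsAdmissible) (n l : ℕ) (p : ℝ × ℝ) :
    M.state n l p =
      M.gauge p * (((√2 * M.γ') ^ n * (√2 * M.γ) ^ l) • Landau.sll.state n l) p := by
  induction n generalizing p with
  | zero =>
    induction l generalizing p with
    | zero => simpa [state] using vac_gauge h p
    | succ l ih =>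
      rw [state_succ_right, sB_gauge ih, map_smul, smul_smul, ← state_succ_right, pow_succ]
      congr 3; ring
  | succ n ih =>
    rw [state_succ_left, sB'_gauge ih, map_smul, smul_smul, ← state_succ_left, pow_succ]
    congr 3; ring

lemma sφ_gauge (h : M.IsAdmissible) (n l : ℕ) (p : ℝ × ℝ) :
    M.sφ (n, l) p =
      M.gauge p * (((√2 * M.γ') ^ n * (√2 * M.γ) ^ l) • Landau.sll.sφ (n, l)) p := by
  simp only [sφ, _root_.smul_apply, smul_eq_mul, state_gauge h n l]
  ring

lemma maps_mulOp {m : ℝ × ℝ → ℂ} {f g : Sch} (h : ∀ p, g p = m p * f p) :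
    Maps (mulOp m) (incl f) (incl g) := by
  have hf : (incl f : ℝ × ℝ → ℂ) =ᵐ[volume] f := SchwartzMap.coeFn_toLp f 2 volume
  have hm : (fun p => m p * (incl f : ℝ × ℝ → ℂ) p) =ᵐ[volume] g := by
    filter_upwards [hf] with p hp
    rw [hp, h]
  refine ⟨(memLp_congr_ae hm).2 (g.memLp 2 volume), ?_⟩
  exact MemLp.toLp_congr ((memLp_congr_ae hm).2 (g.memLp 2 volume)) (g.memLp 2 volume) hm

lemma maps_Tφ (h : M.IsAdmissible) (n l : ℕ) :
    Maps M.Tφ (((√2 * M.γ') ^ n * (√2 * M.γ) ^ l) • Landau.sll.φ (n, l)) (M.φ (n, l)) := by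
  rw [φ, φ, ← map_smul]
  exact maps_mulOp (sφ_gauge h n l)

lemma Sφ_dual : M.dual.Sφ = M.SΨ := by
  rw [← SΨ_dual, dual_dual]

/-- Both families are Gaussian multiples of the same Landau levels, so dividing the two relations
gives the multiplier and the scalars. -/
lemma maps_Sφ (h : M.IsAdmissible) (hΨ : M.NΨ ≠ 0) (n l : ℕ) :
    Maps M.Sφ (M.dual.φ (n, l))
      (((conj M.α' / M.γ') ^ n * (conj M.α / M.γ) ^ l) • M.φ (n, l)) := by
  rw [φ, φ, ← map_smul]
  refine maps_mulOp fun p => ?_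
  have h1 : Real.exp (-(p.1 ^ 2 * M.k₂ - p.2 ^ 2 * M.k₁) / 2) =
      Real.exp (-(p.1 ^ 2 * M.k₂ - p.2 ^ 2 * M.k₁)) *
      Real.exp (-(p.1 ^ 2 * -M.k₂ - p.2 ^ 2 * -M.k₁) / 2) := by
    rw [← Real.exp_add]; congr 1; ring
  have hγ := h.γ_ne
  have hγ' := h.γ'_ne
  rw [_root_.smul_apply, sφ_gauge h, sφ_gauge h.dual, gauge, gauge, h1]
  simp only [dual, _root_.smul_apply, smul_eq_mul, mul_pow, div_pow, ofReal_mul]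
  field_simp

/-- If `f` and `g = S f` are eigenvectors of `K` and `L`, for the same eigenvalue, then
`S K f = L S f`. -/
lemma _root_.Landau.Maps.intertwine {S K L : Hil →ₗ.[ℂ] Hil} {f g : Hil} {c : ℂ}
    (hS : Maps S f g) (hK : Maps K f (c • f)) (hL : Maps L g (c • g)) :
    ∃ u, Maps (prodOp S K) f u ∧ Maps (prodOp L S) f u :=
  ⟨c • g, hK.prodOp (hS.smul c), hS.prodOp hL⟩

end Model

/-! ### Completeness -/

section Moments

variable {F : ℝ × ℝ → ℂ}

lemma norm_linear_le (a b : ℝ) (p : ℝ × ℝ) :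
    ‖((a : ℂ) * p.1 + b * p.2)‖ ≤ (|a| + |b|) * ‖p‖ := by
  refine (norm_add_le _ _).trans ?_
  rw [norm_mul, norm_mul, add_mul]
  simp only [norm_real, Real.norm_eq_abs]
  gcongr
  · exact norm_fst_le p
  · exact norm_snd_le p

/-- A function with exponential decay in mean and vanishing moments has vanishing Fourier
transform. -/
lemma integral_exp_mul_eq_zero (hF : AEStronglyMeasurable F)
    (hexp : ∀ c : ℝ, Integrable (fun p => Real.exp (c * ‖p‖) * ‖F p‖))
    (hmom : ∀ (a b : ℝ) (k : ℕ), ∫ p : ℝ × ℝ, ((a : ℂ) * p.1 + b * p.2) ^ k * F p = 0)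
    (a b : ℝ) : ∫ p : ℝ × ℝ, Complex.exp (I * ((a : ℂ) * p.1 + b * p.2)) * F p = 0 := by
  set θ : ℝ × ℝ → ℂ := fun p => (a : ℂ) * p.1 + b * p.2 with hθ
  have hθc : Continuous θ := by fun_prop
  set c := |a| + |b|
  have hE : ∀ z : ℂ, HasSum (fun k : ℕ => z ^ k / k.factorial) (Complex.exp z) := fun z => by
    rw [Complex.exp_eq_exp_ℂ]; exact NormedSpace.expSeries_div_hasSum_exp z
  have hR : ∀ z : ℝ, HasSum (fun k : ℕ => z ^ k / k.factorial) (Real.exp z) := fun z => by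
    rw [Real.exp_eq_exp_ℝ]; exact NormedSpace.expSeries_div_hasSum_exp z
  have hb : ∀ p, HasSum (fun k : ℕ => (c * ‖p‖) ^ k / k.factorial * ‖F p‖)
      (Real.exp (c * ‖p‖) * ‖F p‖) := fun p => (hR _).mul_right _
  -- Expand the exponential and integrate termwise; the dominating series sums to `exp (c ‖p‖) ‖F
  -- p‖`, and each term is a moment.
  have := hasSum_integral_of_dominated_convergence (μ := (volume : Measure (ℝ × ℝ)))
    (F := fun (k : ℕ) p => (I * θ p) ^ k / k.factorial * F p)
    (f := fun p => Complex.exp (I * θ p) * F p)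
    (fun k p => (c * ‖p‖) ^ k / k.factorial * ‖F p‖)
    (fun k => (by fun_prop : Continuous fun p => (I * θ p) ^ k / k.factorial).aestronglyMeasurable.mul
      hF)
    (fun k => .of_forall fun p => by
      rw [norm_mul, norm_div, norm_pow, norm_mul, norm_I, one_mul, norm_natCast]
      gcongr
      exact norm_linear_le a b p)
    (.of_forall fun p => (hb p).summable)
    (by simpa only [(hb _).tsum_eq] using hexp c)
    (.of_forall fun p => (hE _).mul_right _)
  refine this.unique ?_
  convert hasSum_zero with k
  have h1 : ∀ p, (I * θ p) ^ k / k.factorial * F p = I ^ k / k.factorial * (θ p ^ k * F p) :=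
    fun p => by rw [mul_pow]; ring
  simp_rw [h1, integral_const_mul]
  rw [hmom, mul_zero]

/-- An integrable function on the complex plane is determined by its Fourier transform. -/
lemma ae_eq_zero_of_fourier_eq_zero {G : ℂ → ℂ} (hG : Integrable G)
    (h : ∀ w, FourierTransform.fourier G w = 0) : G =ᵐ[volume] 0 := by
  refine ae_eq_zero_of_integral_contDiff_smul_eq_zero hG.locallyIntegrable fun g hg hgs => ?_
  have hs : HasCompactSupport (fun x => (g x : ℂ)) := hgs.comp_left (g := ((↑) : ℝ → ℂ)) ofReal_zero
  let H : 𝓢(ℂ, ℂ) := hs.toSchwartzMap (ofRealCLM.contDiff.comp hg)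
  have h2 : FourierTransform.fourier (FourierTransformInv.fourierInv H) = H :=
    FourierTransform.fourier_fourierInv_eq H
  -- The test function is the Fourier transform of a Schwartz function, so its integral against `G`
  -- can be moved onto the transform of `G`, which is zero.
  have h1 := VectorFourier.integral_fourierIntegral_smul_eq_flip (L := innerₗ ℂ)
    (μ := (volume : Measure ℂ)) (ν := (volume : Measure ℂ))
    Real.continuous_fourierChar continuous_inner
    (SchwartzMap.integrable (μ := volume) (FourierTransformInv.fourierInv H)) hG
  have h3 : ∀ x, VectorFourier.fourierIntegral Real.fourierChar volume (innerₗ ℂ).flip G x = 0 := by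
    intro x
    rw [flip_innerₗ]
    exact h x
  simp only [h3, smul_zero, integral_zero] at h1
  have h4 : ∀ x, VectorFourier.fourierIntegral Real.fourierChar volume (innerₗ ℂ)
      (FourierTransformInv.fourierInv H : 𝓢(ℂ, ℂ)) x = g x := by
    intro x
    have := congrArg (fun f : 𝓢(ℂ, ℂ) => f x) h2
    exact this
  simp only [h4] at h1
  exact h1

/-- The problem is transported to `ℂ`, whose norm comes from the inner product in the Fourier
kernel, whereas `ℝ × ℝ` carries the sup norm. -/
lemma ae_eq_zero_of_moments_eq_zero (hF : AEStronglyMeasurable F)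
    (hexp : ∀ c : ℝ, Integrable (fun p => Real.exp (c * ‖p‖) * ‖F p‖))
    (hmom : ∀ (a b : ℝ) (k : ℕ), ∫ p : ℝ × ℝ, ((a : ℂ) * p.1 + b * p.2) ^ k * F p = 0) :
    F =ᵐ[volume] 0 := by
  have hint : Integrable F := by
    have := hexp 0
    simp only [zero_mul, Real.exp_zero, one_mul] at this
    exact (integrable_norm_iff hF).1 this
  have hmp := Complex.volume_preserving_equiv_real_prod
  have hG : Integrable (F ∘ measurableEquivRealProd) :=
    (hmp.integrable_comp_emb measurableEquivRealProd.measurableEmbedding).2 hint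
  have h0 := ae_eq_zero_of_fourier_eq_zero hG fun w => by
    rw [Real.fourier_eq']
    have := integral_exp_mul_eq_zero hF hexp hmom (-2 * Real.pi * w.re) (-2 * Real.pi * w.im)
    rw [← hmp.integral_comp measurableEquivRealProd.measurableEmbedding] at this
    rw [← this]
    congr 1; ext v
    rw [smul_eq_mul, Function.comp_apply]
    congr 2
    simp [measurableEquivRealProd_apply, Complex.inner]
    ring_nf
  have := (hmp.symm measurableEquivRealProd).quasiMeasurePreserving.ae_eq_comp h0
  filter_upwards [this] with p hp
  simpa using hp

end Moments

/-- Half of the Gaussian exponent absorbs the linear one by completing the square; the other half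
keeps the product square integrable. -/
lemma exp_mul_norm_mul_exp_quad_le {a b : ℝ} (ha : 0 < a) (hb : 0 < b) (c : ℝ) (p : ℝ × ℝ) :
    Real.exp (c * ‖p‖) * Real.exp (quad a b p) ≤
      Real.exp (c ^ 2 / (2 * min a b)) * Real.exp (quad (a / 2) (b / 2) p) := by
  rw [← Real.exp_add, ← Real.exp_add, Real.exp_le_exp]
  have hm : 0 < min a b := lt_min ha hb
  have h1 := quad_le p ha hb
  have h2 : quad a b p = 2 * quad (a / 2) (b / 2) p := by simp only [quad]; ring
  have h3 : c ^ 2 / (2 * min a b) - c * ‖p‖ + min a b * ‖p‖ ^ 2 / 2 =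
      (c - min a b * ‖p‖) ^ 2 / (2 * min a b) := by field_simp; ring
  have h4 : 0 ≤ c ^ 2 / (2 * min a b) - c * ‖p‖ + min a b * ‖p‖ ^ 2 / 2 := h3 ▸ by positivity
  linarith

/-! ### Polynomials times the vacuum, and density of the span of the states -/

namespace Model

variable {M : Model}

lemma state_mem (n l : ℕ) : M.state n l ∈ Submodule.span ℂ (Set.range M.sφ) := by
  rw [← smul_sφ]
  exact Submodule.smul_mem _ _ (Submodule.subset_span ⟨(n, l), rfl⟩)

lemma map_mem_span {T : Sch →ₗ[ℂ] Sch}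
    (h : ∀ n l, T (M.state n l) ∈ Submodule.span ℂ (Set.range M.sφ)) {f : Sch}
    (hf : f ∈ Submodule.span ℂ (Set.range M.sφ)) :
    T f ∈ Submodule.span ℂ (Set.range M.sφ) := by
  induction hf using Submodule.span_induction with
  | mem f hf =>
    obtain ⟨i, rfl⟩ := hf
    rw [sφ, map_smul]
    exact Submodule.smul_mem _ _ (h _ _)
  | zero => simp
  | add f g _ _ hf hg => rw [map_add]; exact add_mem hf hg
  | smul c f _ hf => rw [map_smul]; exact Submodule.smul_mem _ _ hf

/-- Any linear function combines `x + i y` and `x - i y`; each of these multiplies a state into one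
raised and one lowered state. -/
lemma mLin_state_mem (h : M.IsAdmissible) (a b : ℂ) (n l : ℕ) :
    mLin a b (M.state n l) ∈ Submodule.span ℂ (Set.range M.sφ) := by
  have h1 : mLin a b (M.state n l) = ((a - I * b) / 2) • mLin 1 I (M.state n l) +
      ((a + I * b) / 2) • mLin 1 (-I) (M.state n l) := by
    ext p
    simp only [_root_.add_apply, _root_.smul_apply, mLin_apply, smul_eq_mul]
    linear_combination (b * p.2 * M.state n l p) * I_sq
  rw [h1, mLin_z M h.γ'_ne h.α_ne, mLin_zbar M h.α'_ne h.γ_ne, ← state_succ_left,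
    ← state_succ_right]
  have hA : M.sA (M.state n l) ∈ Submodule.span ℂ (Set.range M.sφ) := by
    cases l with
    | zero => rw [sA_state_zero h]; exact zero_mem _
    | succ l => rw [sA_state_succ h]; exact Submodule.smul_mem _ _ (state_mem _ _)
  have hA' : M.sA' (M.state n l) ∈ Submodule.span ℂ (Set.range M.sφ) := by
    cases n with
    | zero => rw [sA'_state_zero h]; exact zero_mem _
    | succ l => rw [sA'_state_succ h]; exact Submodule.smul_mem _ _ (state_mem _ _)
  exact add_mem (Submodule.smul_mem _ _ (add_mem (Submodule.smul_mem _ _ (state_mem _ _))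
    (Submodule.smul_mem _ _ hA))) (Submodule.smul_mem _ _ (sub_mem (Submodule.smul_mem _ _ hA')
    (Submodule.smul_mem _ _ (state_mem _ _))))

lemma iterate_mLin_vac_mem (h : M.IsAdmissible) (a b : ℂ) (k : ℕ) :
    (mLin a b)^[k] M.vac ∈ Submodule.span ℂ (Set.range M.sφ) := by
  induction k with
  | zero => exact state_mem 0 0
  | succ k ih =>
    rw [Function.iterate_succ_apply']
    exact map_mem_span (mLin_state_mem h a b) ih

lemma iterate_mLin_apply (a b : ℂ) (k : ℕ) (f : Sch) (p : ℝ × ℝ) :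
    (mLin a b)^[k] f p = (a * p.1 + b * p.2) ^ k * f p := by
  induction k with
  | zero => simp
  | succ k ih => rw [Function.iterate_succ_apply', mLin_apply, ih]; ring

theorem isCompleteFamily_φ (h : M.IsAdmissible) (h0 : M.Nφ ≠ 0) : IsCompleteFamily M.φ := by
  rw [IsCompleteFamily, Submodule.topologicalClosure_eq_top_iff, Submodule.eq_bot_iff]
  intro f hf
  have hinc : ∀ u ∈ Submodule.span ℂ (Set.range M.sφ),
      incl u ∈ Submodule.span ℂ (Set.range M.φ) := by
    intro u hu
    have := Submodule.mem_map_of_mem (f := incl) hu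
    rwa [Submodule.map_span, ← Set.range_comp] at this
  have horth : ∀ u ∈ Submodule.span ℂ (Set.range M.sφ), ∫ p, conj (f p) * u p = 0 := by
    intro u hu
    have h1 := (Submodule.mem_orthogonal' _ _).1 hf _ (hinc u hu)
    rw [← h1]
    refine integral_congr_ae ?_
    filter_upwards [SchwartzMap.coeFn_toLp u 2 (volume : Measure (ℝ × ℝ))] with p hp
    change _ = inner ℂ (f p) ((incl u : ℝ × ℝ → ℂ) p)
    rw [show (incl u : ℝ × ℝ → ℂ) p = u p from hp]
    simp [mul_comm]
  have hfm := (Lp.memLp f)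
  have hF : (fun p => conj (f p) * M.vac p) =ᵐ[volume] 0 := by
    refine ae_eq_zero_of_moments_eq_zero ?_ (fun c => ?_) (fun a b k => ?_)
    · exact hfm.1.star.mul M.vac.continuous.aestronglyMeasurable
    · obtain ⟨ha, hb⟩ := h.coeff_pos
      have hg := ((gaussian (half_pos ha) (half_pos hb)).memLp 2
        (volume : Measure (ℝ × ℝ))).norm.const_mul
        (‖M.Nφ‖ * Real.exp (c ^ 2 / (2 * min ((1 + 2 * M.k₂) / 4) ((1 - 2 * M.k₁) / 4))))
      -- The widened Gaussian and `f` are both in `L²`, so their product is an integrable majorant.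
      have hi := hg.integrable_mul hfm.norm
      refine hi.mono' ?_ (.of_forall fun p => ?_)
      · exact (by fun_prop : Continuous fun p : ℝ × ℝ => Real.exp (c * ‖p‖)).aestronglyMeasurable.mul
          (hfm.1.star.mul M.vac.continuous.aestronglyMeasurable).norm
      · have := exp_mul_norm_mul_exp_quad_le ha hb c p
        rw [vac_eq h, _root_.smul_apply, gaussian_apply]
        simp only [Pi.mul_apply, gaussian_apply, norm_mul, norm_real, Real.norm_eq_abs,
          Real.abs_exp, norm_smul, RCLike.norm_conj, abs_norm]
        calc _ = ‖M.Nφ‖ * ‖f p‖ * (Real.exp (c * ‖p‖) *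
              Real.exp (quad ((1 + 2 * M.k₂) / 4) ((1 - 2 * M.k₁) / 4) p)) := by ring
          _ ≤ ‖M.Nφ‖ * ‖f p‖ * _ := mul_le_mul_of_nonneg_left this (by positivity)
          _ = _ := by ring
    · rw [← horth _ (iterate_mLin_vac_mem h a b k)]
      congr 1; ext p
      rw [iterate_mLin_apply]; ring
  refine (Lp.eq_zero_iff_ae_eq_zero).2 ?_
  filter_upwards [hF] with p hp
  have hv : M.vac p ≠ 0 := by
    rw [vac_apply h, vacφ]
    exact mul_ne_zero h0 (ofReal_ne_zero.2 (Real.exp_pos _).ne')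
  simpa [hv] using hp

end Model

/-! ### Unboundedness -/

/-- If `‖m p‖` exceeds the operator bound, it does so on a small ball around `p`, and the indicator
of that ball violates the bound. -/
lemma norm_le_of_isBoundedOp {m : ℝ × ℝ → ℂ} (hm : Continuous m) (h : IsBoundedOp (mulOp m)) :
    ∃ C, ∀ p, ‖m p‖ ≤ C := by
  obtain ⟨C, hC⟩ := h
  refine ⟨C, fun p => ?_⟩
  by_contra! hp
  obtain ⟨ε, hε, hball⟩ := Metric.nhds_basis_closedBall.eventually_iff.1
    (hm.norm.continuousAt.eventually (lt_mem_nhds hp))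
  have hK : IsCompact (Metric.closedBall p ε) := isCompact_closedBall p ε
  -- The minimum of `‖m‖` on the compact ball still exceeds `C`, giving a uniform lower bound.
  obtain ⟨q, hq, hqmin⟩ := hK.exists_isMinOn ⟨p, Metric.mem_closedBall_self hε.le⟩
    hm.norm.continuousOn
  obtain ⟨D, hD⟩ := hK.exists_bound_of_continuousOn hm.continuousOn
  have hfin : volume (Metric.closedBall p ε) ≠ ⊤ := hK.measure_lt_top.ne
  set f : Hil := indicatorConstLp 2 Metric.isClosed_closedBall.measurableSet hfin (1 : ℂ) with hf
  have hfe : (f : ℝ × ℝ → ℂ) =ᵐ[volume] (Metric.closedBall p ε).indicator fun _ => 1 :=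
    indicatorConstLp_coeFn
  have hmem : f ∈ (mulOp m).domain := by
    refine (Lp.memLp f).norm.const_mul D |>.mono (hm.aestronglyMeasurable.mul
      (Lp.aestronglyMeasurable f)) ?_
    filter_upwards [hfe] with x hx
    by_cases hxK : x ∈ Metric.closedBall p ε
    · rw [hx, Set.indicator_of_mem hxK]
      simpa using (hD x hxK).trans (le_abs_self D)
    · rw [hx, Set.indicator_of_notMem hxK]; simp
  have hle : ‖(‖m q‖ : ℂ) • f‖ ≤ ‖mulOp m ⟨f, hmem⟩‖ := by
    refine Lp.norm_le_norm_of_ae_le ?_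
    filter_upwards [hfe, MemLp.coeFn_toLp (μ := volume) (p := 2) hmem,
      Lp.coeFn_smul (‖m q‖ : ℂ) f] with x hx h1 h2
    rw [h2]
    change _ ≤ ‖(MemLp.toLp (fun p => m p * f p) hmem : Hil) x‖
    rw [h1, Pi.smul_apply, hx]
    by_cases hxK : x ∈ Metric.closedBall p ε
    · rw [Set.indicator_of_mem hxK]
      simpa using isMinOn_iff.1 hqmin x hxK
    · rw [Set.indicator_of_notMem hxK]; simp
  have hpos : 0 < ‖f‖ := by
    rw [hf, norm_indicatorConstLp (by simp) (by simp)]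
    have : 0 < volume.real (Metric.closedBall p ε) :=
      ENNReal.toReal_pos (Metric.measure_closedBall_pos volume p hε).ne' hfin
    simp only [norm_one, one_mul]
    positivity
  have h1 := hle.trans (hC ⟨f, hmem⟩)
  rw [norm_smul, norm_real, norm_norm] at h1
  exact absurd (le_of_mul_le_mul_right h1 hpos) (not_le.2 (hball hq))

lemma isBoundedOp_mulOp_const (c : ℂ) : IsBoundedOp (mulOp fun _ => c) := by
  refine ⟨‖c‖, fun f => ?_⟩
  rw [← norm_smul]
  refine Lp.norm_le_norm_of_ae_le ?_
  filter_upwards [MemLp.coeFn_toLp (μ := volume) (p := 2) f.2, Lp.coeFn_smul c (f : Hil)]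
    with x h1 h2
  rw [h2]
  exact (congrArg norm h1).le

lemma eq_zero_of_exp_mul_sq_le {k C : ℝ} (h : ∀ t : ℝ, Real.exp (k * t ^ 2) ≤ C) : k ≤ 0 := by
  by_contra! hk
  obtain ⟨t, ht⟩ : ∃ t : ℝ, C < k * t ^ 2 := by
    -- Chosen so that `k t² = |C| + k > C`.
    refine ⟨√(|C| / k + 1), ?_⟩
    rw [Real.sq_sqrt (by positivity)]
    have : k * (|C| / k + 1) = |C| + k := by field_simp
    have := le_abs_self C
    linarith
  have := Real.add_one_le_exp (k * t ^ 2)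
  linarith [h t]

lemma le_zero_of_isBoundedOp_exp {c : ℂ} (hc : c ≠ 0) {a b : ℝ}
    (h : IsBoundedOp (mulOp fun p => c * Real.exp (quad a b p))) : 0 ≤ a ∧ 0 ≤ b := by
  obtain ⟨C, hC⟩ := norm_le_of_isBoundedOp (by unfold quad; fun_prop) h
  have hc' : 0 < ‖c‖ := norm_pos_iff.2 hc
  have h1 : ∀ p, Real.exp (quad a b p) ≤ C / ‖c‖ := fun p => by
    rw [le_div_iff₀' hc']
    simpa [norm_real, Real.abs_exp] using hC p
  constructor
  · have := eq_zero_of_exp_mul_sq_le (k := -a) (C := C / ‖c‖) fun t => by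
      simpa [quad] using h1 (t, 0)
    linarith
  · have := eq_zero_of_exp_mul_sq_le (k := -b) (C := C / ‖c‖) fun t => by
      simpa [quad] using h1 (0, t)
    linarith

/-- Multiplication by a Gaussian factor and by its inverse are both bounded only if the factor is
constant. -/
lemma isBoundedOp_exp_quad_iff {c d : ℂ} (hc : c ≠ 0) (hd : d ≠ 0) (a b : ℝ) :
    (IsBoundedOp (mulOp fun p => c * Real.exp (quad a b p)) ∧
      IsBoundedOp (mulOp fun p => d * Real.exp (quad (-a) (-b) p))) ↔ (b = 0 ∧ a = 0) := by
  constructor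
  · rintro ⟨h1, h2⟩
    have := le_zero_of_isBoundedOp_exp hc h1
    have := le_zero_of_isBoundedOp_exp hd h2
    constructor <;> linarith
  · rintro ⟨rfl, rfl⟩
    have : ∀ p, quad 0 0 p = 0 := fun p => by simp [quad]
    simp only [neg_zero, this]
    exact ⟨isBoundedOp_mulOp_const _, isBoundedOp_mulOp_const _⟩

/-! ### Riesz bases -/

/-- Biorthogonality forces `V* gᵢ = eᵢ`, so `‖fᵢ‖ ≤ ‖V‖` and `‖gᵢ‖ ≤ ‖V⁻¹‖`. -/
lemma IsRieszBasis.exists_bound {ι : Type*} [DecidableEq ι] {f g : ι → Hil} (hf : IsRieszBasis f)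
    (h : ∀ i j, inner ℂ (g i) (f j) = if i = j then (1 : ℂ) else 0) :
    ∃ C, ∀ i, ‖f i‖ * ‖g i‖ ≤ C := by
  obtain ⟨V, e, hV⟩ := hf
  have h1 : ∀ i x, inner ℂ (g i) (V x) = inner ℂ (e i) x := by
    intro i x
    have key : ContinuousLinearMap.adjoint (V : Hil →L[ℂ] Hil) (g i) = e i := by
      refine e.repr.injective (lp.ext (funext fun j => ?_))
      rw [e.repr_apply_apply, e.repr_apply_apply, ContinuousLinearMap.adjoint_inner_right,
        orthonormal_iff_ite.1 e.orthonormal, ← inner_conj_symm]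
      have := h i j
      rw [hV] at this
      rw [ContinuousLinearEquiv.coe_coe, this]
      simp [eq_comm, apply_ite]
    rw [← key, ContinuousLinearMap.adjoint_inner_left]; rfl
  refine ⟨‖(V : Hil →L[ℂ] Hil)‖ * ‖(V.symm : Hil →L[ℂ] Hil)‖, fun i => ?_⟩
  have he : ‖e i‖ = 1 := e.orthonormal.1 i
  gcongr
  · rw [hV]
    simpa [he] using (V : Hil →L[ℂ] Hil).le_opNorm (e i)
  · have h2 := h1 i (V.symm (g i))
    rw [V.apply_symm_apply] at h2
    -- Write the second `gᵢ` in `⟨gᵢ, gᵢ⟩` as `V (V⁻¹ gᵢ)` and apply Cauchy–Schwarz to `⟨eᵢ, V⁻¹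
    -- gᵢ⟩`.
    have h3 : ‖g i‖ * ‖g i‖ ≤ ‖(V.symm : Hil →L[ℂ] Hil)‖ * ‖g i‖ := by
      calc ‖g i‖ * ‖g i‖ = ‖(inner ℂ (g i) (g i) : ℂ)‖ := by
            rw [inner_self_eq_norm_sq_to_K]; simp [sq]
        _ = ‖(inner ℂ (e i) (V.symm (g i)) : ℂ)‖ := by rw [h2]
        _ ≤ ‖e i‖ * ‖V.symm (g i)‖ := norm_inner_le_norm _ _
        _ ≤ _ := by
          rw [he, one_mul]; exact (V.symm : Hil →L[ℂ] Hil).le_opNorm (g i)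
    rcases (norm_nonneg (g i)).eq_or_lt with h0 | h0
    · rw [← h0]; positivity
    · exact le_of_mul_le_mul_right h3 h0

/-! ### Growth of the norms of the states -/

/-- A Gamma integral. The odd exponent is `r ^ (2 n)` times the polar Jacobian `r`. -/
lemma integral_pow_mul_exp_neg_mul_sq (n : ℕ) {s : ℝ} (hs : 0 < s) :
    ∫ r in Set.Ioi (0 : ℝ), r ^ (2 * n + 1) * Real.exp (-s * r ^ 2) =
      n.factorial / (2 * s ^ (n + 1)) := by
  have h := _root_.integral_rpow_mul_exp_neg_mul_rpow (p := 2) (q := (2 * n + 1 : ℕ)) (b := s)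
    (by norm_num) (by push_cast; linarith [n.cast_nonneg (α := ℝ)]) hs
  have h1 : (((2 * n + 1 : ℕ) : ℝ) + 1) / 2 = n + 1 := by push_cast; ring
  rw [neg_div, h1, Real.Gamma_nat_eq_factorial, Real.rpow_neg hs.le] at h
  simp only [Real.rpow_natCast, Real.rpow_ofNat] at h
  rw [h, ← Nat.cast_succ, Real.rpow_natCast]
  field_simp

lemma integrable_pow_mul_exp_neg_mul_sq (n : ℕ) {s : ℝ} (hs : 0 < s) :
    IntegrableOn (fun r : ℝ => r ^ (2 * n + 1) * Real.exp (-s * r ^ 2)) (Set.Ioi 0) := by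
  have h := integrableOn_rpow_mul_exp_neg_mul_sq hs (s := (2 * n + 1 : ℕ))
    (by push_cast; linarith [n.cast_nonneg (α := ℝ)])
  simpa only [Real.rpow_natCast] using h

/-- Lower bound for Gaussian moments, by restriction to a sector in which the quadratic form is
at most `s` on the unit circle. -/
lemma le_integral_of_sector {a b s θ₁ θ₂ : ℝ} (hs : 0 < s) (hθ : θ₁ ≤ θ₂)
    (hsec : ∀ θ ∈ Set.Ioo θ₁ θ₂, θ ∈ Set.Ioo (-Real.pi) Real.pi ∧
      a * Real.cos θ ^ 2 + b * Real.sin θ ^ 2 ≤ s) (n : ℕ)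
    (hint : Integrable fun p : ℝ × ℝ => (p.1 ^ 2 + p.2 ^ 2) ^ n * Real.exp (quad a b p)) :
    (θ₂ - θ₁) * (n.factorial / (2 * s ^ (n + 1))) ≤
      ∫ p : ℝ × ℝ, (p.1 ^ 2 + p.2 ^ 2) ^ n * Real.exp (quad a b p) := by
  have hpos : ∀ p : ℝ × ℝ, 0 ≤ (p.1 ^ 2 + p.2 ^ 2) ^ n * Real.exp (quad a b p) :=
    fun p => by positivity
  rw [← ENNReal.ofReal_le_ofReal_iff (integral_nonneg hpos),
    ofReal_integral_eq_lintegral_ofReal hint (.of_forall hpos),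
    ← lintegral_comp_polarCoord_symm, ENNReal.ofReal_mul (by linarith),
    ← integral_pow_mul_exp_neg_mul_sq n hs, ofReal_integral_eq_lintegral_ofReal
      (integrable_pow_mul_exp_neg_mul_sq n hs)
      ((ae_restrict_iff' measurableSet_Ioi).2 (.of_forall fun r hr => by
        have : 0 < r := hr
        change 0 ≤ r ^ (2 * n + 1) * Real.exp (-s * r ^ 2)
        positivity))]
  set S : Set (ℝ × ℝ) := Set.Ioi 0 ×ˢ Set.Ioo θ₁ θ₂
  have hS : MeasurableSet S := measurableSet_Ioi.prod measurableSet_Ioo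
  have hST : S ⊆ polarCoord.target := fun p hp => ⟨hp.1, (hsec p.2 hp.2).1⟩
  calc _ = ∫⁻ p in S, ENNReal.ofReal (p.1 ^ (2 * n + 1) * Real.exp (-s * p.1 ^ 2)) := by
        rw [Measure.volume_eq_prod, ← Measure.prod_restrict]
        have := lintegral_prod_mul (μ := volume.restrict (Set.Ioi (0 : ℝ)))
          (ν := volume.restrict (Set.Ioo θ₁ θ₂))
          (f := fun r => ENNReal.ofReal (r ^ (2 * n + 1) * Real.exp (-s * r ^ 2)))
          (g := fun _ => 1) (by fun_prop) (by fun_prop)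
        simp only [mul_one, lintegral_const, Measure.restrict_apply_univ, Real.volume_Ioo,
          one_mul] at this
        rw [this, mul_comm]
    _ ≤ ∫⁻ p in S, ENNReal.ofReal p.1 • ENNReal.ofReal
          (((polarCoord.symm p).1 ^ 2 + (polarCoord.symm p).2 ^ 2) ^ n *
            Real.exp (quad a b (polarCoord.symm p))) := by
        refine setLIntegral_mono' hS fun p hp => ?_
        have hr : 0 < p.1 := hp.1
        rw [smul_eq_mul, ← ENNReal.ofReal_mul hr.le]
        refine ENNReal.ofReal_le_ofReal ?_
        have h1 : (p.1 * Real.cos p.2) ^ 2 + (p.1 * Real.sin p.2) ^ 2 = p.1 ^ 2 := by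
          linear_combination p.1 ^ 2 * Real.sin_sq_add_cos_sq p.2
        have h2 : -s * p.1 ^ 2 ≤ quad a b (p.1 * Real.cos p.2, p.1 * Real.sin p.2) := by
          have := mul_le_mul_of_nonneg_left (hsec p.2 hp.2).2 (sq_nonneg p.1)
          simp only [quad]
          linarith
        simp only [polarCoord_symm_apply]
        rw [h1, ← pow_mul, ← mul_assoc, ← pow_succ']
        gcongr
    _ ≤ _ := lintegral_mono_set hST

/-- Strict inequalities at `θ` persist nearby. One sector must serve both functions, because the
norms of `φ_{n,0}` and `Ψ_{n,0}` are bounded below on the same one. -/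
lemma exists_sector {f : ℝ → ℝ} (hf : Continuous f) {g : ℝ → ℝ} (hg : Continuous g) {θ s t : ℝ}
    (hθ : θ ∈ Set.Ioo (-Real.pi) Real.pi) (hs : f θ < s) (ht : g θ < t) :
    ∃ θ₁ θ₂, θ₁ < θ₂ ∧ ∀ x ∈ Set.Ioo θ₁ θ₂, x ∈ Set.Ioo (-Real.pi) Real.pi ∧ f x ≤ s ∧ g x ≤ t := by
  have h1 : ∀ᶠ x in nhds θ, x ∈ Set.Ioo (-Real.pi) Real.pi ∧ f x ≤ s ∧ g x ≤ t := by
    filter_upwards [isOpen_Ioo.mem_nhds hθ, hf.continuousAt.eventually (gt_mem_nhds hs),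
      hg.continuousAt.eventually (gt_mem_nhds ht)] with x h1 h2 h3
    exact ⟨h1, h2.le, h3.le⟩
  obtain ⟨l, u, hm, hsub⟩ := mem_nhds_iff_exists_Ioo_subset.1 h1
  exact ⟨l, u, hm.1.trans hm.2, hsub⟩

lemma norm_incl_sq (f : Sch) : ‖incl f‖ ^ 2 = ∫ p, ‖f p‖ ^ 2 := by
  have h1 := inner_incl f f
  rw [inner_self_eq_norm_sq_to_K] at h1
  have h2 : ∀ p, conj (f p) * f p = ((‖f p‖ ^ 2 : ℝ) : ℂ) := fun p => by
    rw [mul_comm, mul_conj, normSq_eq_norm_sq]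
  simp_rw [h2] at h1
  rw [integral_complex_ofReal] at h1
  refine ofReal_injective ?_
  rw [ofReal_pow]
  exact h1

namespace Model

variable {M : Model}

/-- `A` kills these states, so in `mLin_z` only the creation term survives and `B'` acts as
multiplication by `γ' (x + i y)`. -/
lemma state_left_apply (h : M.IsAdmissible) (n : ℕ) (p : ℝ × ℝ) :
    M.state n 0 p = (M.γ' * (p.1 + I * p.2)) ^ n * M.vacφ p := by
  induction n with
  | zero => simpa [state] using vac_apply h p
  | succ n ih =>
    have h1 := congrArg (fun f : Sch => M.γ' * f p) (M.mLin_z h.γ'_ne h.α_ne (M.state n 0))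
    simp only [sA_state_zero h, smul_zero, add_zero, _root_.smul_apply, smul_eq_mul, mLin_apply,
      mul_inv_cancel_left₀ h.γ'_ne, one_mul] at h1
    rw [state_succ_left, ← h1, ih]; ring

lemma norm_φ_sq_eq (h : M.IsAdmissible) (n : ℕ) (p : ℝ × ℝ) :
    ‖M.sφ (n, 0) p‖ ^ 2 = ‖M.Nφ‖ ^ 2 * (‖M.γ'‖ ^ 2) ^ n / n.factorial *
      ((p.1 ^ 2 + p.2 ^ 2) ^ n *
        Real.exp (quad ((1 + 2 * M.k₂) / 2) ((1 - 2 * M.k₁) / 2) p)) := by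
  have h1 : ‖(p.1 + I * p.2 : ℂ)‖ ^ 2 = p.1 ^ 2 + p.2 ^ 2 := by
    rw [← normSq_eq_norm_sq, normSq_apply]; simp; ring
  have h2 : Real.exp (quad ((1 + 2 * M.k₂) / 2) ((1 - 2 * M.k₁) / 2) p) =
      Real.exp (-(p.1 ^ 2 / 4) * (1 + 2 * M.k₂) - (p.2 ^ 2 / 4) * (1 - 2 * M.k₁)) ^ 2 := by
    rw [← Real.exp_nat_mul]; congr 1; simp only [quad]; push_cast; ring
  rw [sφ, _root_.smul_apply, state_left_apply h, vacφ, h2, ← h1]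
  simp only [norm_smul, norm_mul, norm_pow, norm_inv, norm_real, Real.norm_eq_abs, Real.abs_exp,
    mul_pow, inv_pow, sq_abs, Nat.factorial_zero, Nat.cast_one, mul_one]
  rw [Real.sq_sqrt (by positivity), pow_right_comm _ n 2, pow_right_comm _ n 2]
  field_simp

/-- The `n!` of the radial moment cancels the normalisation `1/n!`, leaving a geometric sequence of
ratio `‖γ'‖² / s`. -/
lemma le_norm_φ_sq (h : M.IsAdmissible) (h0 : M.Nφ ≠ 0) {s θ₁ θ₂ : ℝ} (hs : 0 < s) (hθ : θ₁ ≤ θ₂)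
    (hsec : ∀ θ ∈ Set.Ioo θ₁ θ₂, θ ∈ Set.Ioo (-Real.pi) Real.pi ∧
      (1 + 2 * M.k₂) / 2 * Real.cos θ ^ 2 + (1 - 2 * M.k₁) / 2 * Real.sin θ ^ 2 ≤ s) (n : ℕ) :
    ‖M.Nφ‖ ^ 2 * (‖M.γ'‖ ^ 2) ^ n * ((θ₂ - θ₁) / (2 * s ^ (n + 1))) ≤ ‖M.φ (n, 0)‖ ^ 2 := by
  have hN : 0 < ‖M.Nφ‖ := norm_pos_iff.2 h0
  have hγ : 0 < ‖M.γ'‖ := norm_pos_iff.2 h.γ'_ne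
  set K := ‖M.Nφ‖ ^ 2 * (‖M.γ'‖ ^ 2) ^ n / n.factorial with hK
  have hKpos : 0 < K := by positivity
  have hint : Integrable fun p : ℝ × ℝ => (p.1 ^ 2 + p.2 ^ 2) ^ n *
        Real.exp (quad ((1 + 2 * M.k₂) / 2) ((1 - 2 * M.k₁) / 2) p) := by
    have := ((M.sφ (n, 0)).memLp 2 (volume : Measure (ℝ × ℝ))).integrable_norm_pow (by norm_num)
    simp only [norm_φ_sq_eq h] at this
    exact (integrable_const_mul_iff hKpos.ne'.isUnit _).1 this
  have := mul_le_mul_of_nonneg_left (le_integral_of_sector hs hθ hsec n hint) hKpos.le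
  rw [φ, norm_incl_sq]
  simp only [norm_φ_sq_eq h]
  rw [integral_const_mul]
  refine le_trans (le_of_eq ?_) this
  rw [hK]; field_simp

/-- A coordinate axis suffices: the `x` axis with `q = k₂` if `k₂ ≠ 0`, otherwise the `y` axis with
`q = -k₁`. -/
lemma exists_direction (h : M.IsAdmissible) (hk : ¬ (M.k₁ = 0 ∧ M.k₂ = 0)) :
    ∃ θ ∈ Set.Ioo (-Real.pi) Real.pi, ∃ q : ℝ, 0 < 1 / 2 + q ∧ 0 < 1 / 2 - q ∧ q ≠ 0 ∧
      (1 + 2 * M.k₂) / 2 * Real.cos θ ^ 2 + (1 - 2 * M.k₁) / 2 * Real.sin θ ^ 2 = 1 / 2 + q ∧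
      (1 - 2 * M.k₂) / 2 * Real.cos θ ^ 2 + (1 + 2 * M.k₁) / 2 * Real.sin θ ^ 2 = 1 / 2 - q := by
  have hpi := Real.pi_pos
  obtain ⟨h1, h1'⟩ := h.k₁
  obtain ⟨h2, h2'⟩ := h.k₂
  by_cases hk2 : M.k₂ = 0
  · have hk1 : M.k₁ ≠ 0 := fun h1 => hk ⟨h1, hk2⟩
    refine ⟨Real.pi / 2, ⟨by linarith, by linarith⟩, -M.k₁, by linarith, by linarith,
      neg_ne_zero.2 hk1, ?_, ?_⟩ <;> simp <;> ring
  · refine ⟨0, ⟨by linarith, by linarith⟩, M.k₂, by linarith, by linarith, hk2, ?_, ?_⟩ <;>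
      simp <;> ring

lemma not_isRieszBasis (h : M.IsAdmissible) (hφ : M.Nφ ≠ 0) (hΨ : M.NΨ ≠ 0)
    (h0 : pairing M.dual.vac M.vac = 1) (hk : ¬ (M.k₁ = 0 ∧ M.k₂ = 0)) :
    ¬ IsRieszBasis M.φ := by
  intro hR
  obtain ⟨C, hC⟩ := hR.exists_bound (inner_dual_φ h h0)
  obtain ⟨θ, hθ, q, hq1, hq2, hq0, hqa, hqb⟩ := exists_direction h hk
  -- Room for the sector: with this `ε`, `4 s t = 1 - 2 q² + q⁴`, still below `1`.
  set ε := q ^ 2 / 2 with hε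
  have hεpos : 0 < ε := by positivity
  have hq4 : q ^ 2 < 1 / 4 := by nlinarith
  set s := 1 / 2 + q + ε with hs
  set t := 1 / 2 - q + ε with ht
  have hspos : 0 < s := by positivity
  have htpos : 0 < t := by positivity
  have hst : 4 * (s * t) < 1 := by
    have : 4 * (s * t) = 1 + 4 * ε + 4 * ε ^ 2 - 4 * q ^ 2 := by rw [hs, ht]; ring
    rw [this, hε]; nlinarith [sq_nonneg q, mul_pos hεpos hεpos]
  obtain ⟨θ₁, θ₂, hlt, hsec⟩ := exists_sector
    (f := fun θ => (1 + 2 * M.k₂) / 2 * Real.cos θ ^ 2 + (1 - 2 * M.k₁) / 2 * Real.sin θ ^ 2)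
    (by fun_prop)
    (g := fun θ => (1 - 2 * M.k₂) / 2 * Real.cos θ ^ 2 + (1 + 2 * M.k₁) / 2 * Real.sin θ ^ 2)
    (by fun_prop) hθ (s := s) (t := t) (by linarith) (by linarith)
  have hbφ := le_norm_φ_sq h hφ hspos hlt.le fun x hx => ⟨(hsec x hx).1, (hsec x hx).2.1⟩
  have hbΨ := le_norm_φ_sq h.dual (s := t) hΨ htpos hlt.le fun x hx => ⟨(hsec x hx).1, by
    simpa [dual, sub_eq_add_neg] using (hsec x hx).2.2⟩
  have hαγ : ‖M.γ'‖ ^ 2 * ‖M.dual.γ'‖ ^ 2 = 1 / 4 := by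
    have := congrArg norm h.αγ'
    rw [norm_mul] at this
    simp only [dual, RCLike.norm_conj]
    rw [← mul_pow, mul_comm, this]; norm_num
  set L := ‖M.Nφ‖ ^ 2 * ‖M.NΨ‖ ^ 2 * (θ₂ - θ₁) ^ 2 / (4 * (s * t)) with hL
  have hLpos : 0 < L := by
    have := sub_pos.2 hlt
    have h1 := norm_pos_iff.2 hφ
    have h2 := norm_pos_iff.2 hΨ
    positivity
  -- The ratios of the two lower bounds multiply to `‖γ' α'‖² / (s t) = 1 / (4 s t) > 1`, which no
  -- constant can dominate.
  have hgrow : ∀ n : ℕ, L * ((4 * (s * t))⁻¹) ^ n ≤ C ^ 2 := by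
    intro n
    have h1 : 0 ≤ ‖M.φ (n, 0)‖ * ‖M.dual.φ (n, 0)‖ := by positivity
    have h2 := pow_le_pow_left₀ h1 (hC (n, 0)) 2
    have hsub := sub_pos.2 hlt
    have h3 := mul_le_mul (hbφ n) (hbΨ n) (by positivity) (by positivity)
    rw [← mul_pow] at h3
    refine le_trans (le_of_eq ?_) (h3.trans h2)
    have h4 : (‖M.γ'‖ ^ 2) ^ n * (‖M.dual.γ'‖ ^ 2) ^ n = (1 / 4) ^ n := by rw [← mul_pow, hαγ]
    rw [show M.dual.Nφ = M.NΨ from rfl]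
    calc _ = ‖M.Nφ‖ ^ 2 * ‖M.NΨ‖ ^ 2 * (θ₂ - θ₁) ^ 2 * (1 / 4) ^ n /
          (4 * s ^ (n + 1) * t ^ (n + 1)) := by
          rw [hL, inv_pow, mul_pow, mul_pow, div_pow, one_pow]; field_simp; ring
      _ = _ := by rw [← h4]; field_simp; ring
  have hone : 1 < (4 * (s * t))⁻¹ := (one_lt_inv₀ (by positivity)).2 hst
  obtain ⟨n, hn⟩ := pow_unbounded_of_one_lt (C ^ 2 / L) hone
  rw [div_lt_iff₀' hLpos] at hn
  exact absurd (hgrow n) (not_le.2 hn)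

end Model

/-! ### Assembly -/

namespace Model

variable {M : Model}

lemma ne_zero_of_integral (hN : ∫ p : ℝ × ℝ, conj (M.vacφ p) * M.vacΨ p = 1) :
    M.Nφ ≠ 0 ∧ M.NΨ ≠ 0 := by
  constructor <;> rintro h0 <;> simp [vacφ, vacΨ, h0] at hN

lemma pairing_vac (h : M.IsAdmissible) (hN : ∫ p : ℝ × ℝ, conj (M.vacφ p) * M.vacΨ p = 1) :
    pairing M.dual.vac M.vac = 1 := by
  have h1 : pairing M.vac M.dual.vac = 1 := by
    rw [← hN]
    simp only [pairing, vac_apply h, vac_apply h.dual, vacφ_dual]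
  rw [pairing_eq_inner, ← inner_conj_symm, ← pairing_eq_inner, h1, map_one]

lemma dual_sll : Landau.sll.dual = Landau.sll := by simp [dual, sll]

lemma integral_vac_sll :
    ∫ p : ℝ × ℝ, conj (Landau.sll.vacφ p) * Landau.sll.vacΨ p = 1 := by
  have hpi : (0 : ℝ) < 2 * Real.pi := by positivity
  have h1 : ∀ p : ℝ × ℝ, conj (Landau.sll.vacφ p) * Landau.sll.vacΨ p =
      (((2 * Real.pi)⁻¹ * (Real.exp (-(1 / 2) * p.1 ^ 2) * Real.exp (-(1 / 2) * p.2 ^ 2)) : ℝ) : ℂ) := by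
    intro p
    simp only [vacφ, vacΨ, sll, conj_ofReal, ← ofReal_mul]
    congr 1
    have h2 : 1 / √(2 * Real.pi) * (1 / √(2 * Real.pi)) = (2 * Real.pi)⁻¹ := by
      rw [div_mul_div_comm, Real.mul_self_sqrt hpi.le]; simp
    rw [← h2, ← Real.exp_add, mul_mul_mul_comm, ← Real.exp_add]
    congr 2; ring
  simp_rw [h1]
  rw [integral_complex_ofReal, integral_const_mul, Measure.volume_eq_prod,
    integral_prod_mul (fun x : ℝ => Real.exp (-(1 / 2) * x ^ 2))
      (fun y : ℝ => Real.exp (-(1 / 2) * y ^ 2)), integral_gaussian,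
    Real.mul_self_sqrt (by positivity)]
  norm_cast
  field_simp

/-- The unperturbed model is its own dual, so biorthogonality becomes orthonormality. -/
lemma orthonormal_sll : Orthonormal ℂ Landau.sll.φ := by
  rw [orthonormal_iff_ite]
  intro i j
  have := inner_dual_φ .sll (pairing_vac .sll integral_vac_sll) i j
  rwa [dual_sll] at this

lemma isAdj_sH (h : M.IsAdmissible) : IsAdj M.sH M.dual.sH := by
  have hid : IsAdj LinearMap.id LinearMap.id := fun u v => rfl
  have h1 := (M.isAdj_sB.comp M.isAdj_sA).add (hid.smul (1 / 2))
  convert h1 using 1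
  · ext1 f; exact M.sH_eq h.αγ f
  · ext1 f
    refine (M.dual.sH_eq h.dual.αγ f).trans ?_
    simp [conj_two]

lemma isAdj_sH' (h : M.IsAdmissible) : IsAdj M.sH' M.dual.sH' := by
  have hid : IsAdj LinearMap.id LinearMap.id := fun u v => rfl
  have h1 := (M.isAdj_sB'.comp M.isAdj_sA').add (hid.smul (1 / 2))
  convert h1 using 1
  · ext1 f; exact M.sH'_eq h.αγ' f
  · ext1 f
    refine (M.dual.sH'_eq h.dual.αγ' f).trans ?_
    simp [conj_two]

lemma sH_sφ (h : M.IsAdmissible) (i : ℕ × ℕ) : M.sH (M.sφ i) = (i.2 + 1 / 2 : ℂ) • M.sφ i := by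
  rw [sH_eq M h.αγ, sB_sA_sφ h, add_smul]

lemma sH'_sφ (h : M.IsAdmissible) (i : ℕ × ℕ) : M.sH' (M.sφ i) = (i.1 + 1 / 2 : ℂ) • M.sφ i := by
  rw [sH'_eq M h.αγ', sB'_sA'_sφ h, add_smul]

lemma isBoundedOp_Tφ_iff (h0 : M.Nφ ≠ 0) :
    (IsBoundedOp M.Tφ ∧ IsBoundedOp M.TφInv) ↔ (M.k₁ = 0 ∧ M.k₂ = 0) := by
  have hc : (√(2 * Real.pi) * M.Nφ : ℂ) ≠ 0 :=
    mul_ne_zero (ofReal_ne_zero.2 (Real.sqrt_pos.2 (by positivity)).ne') h0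
  have := isBoundedOp_exp_quad_iff hc (inv_ne_zero hc) (M.k₂ / 2) (-M.k₁ / 2)
  have h1 : M.Tφ = mulOp fun p => √(2 * Real.pi) * M.Nφ *
      Real.exp (quad (M.k₂ / 2) (-M.k₁ / 2) p) := by
    simp only [Tφ, quad]; congr! 5; ring
  have h2 : M.TφInv = mulOp fun p => (√(2 * Real.pi) * M.Nφ)⁻¹ *
      Real.exp (quad (-(M.k₂ / 2)) (-(-M.k₁ / 2)) p) := by
    simp only [TφInv, quad]; congr! 5; ring
  rw [h1, h2, this]
  simp

lemma isBoundedOp_Sφ_iff (h0 : M.Nφ ≠ 0) (h0' : M.NΨ ≠ 0) :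
    (IsBoundedOp M.Sφ ∧ IsBoundedOp M.SΨ) ↔ (M.k₁ = 0 ∧ M.k₂ = 0) := by
  have := isBoundedOp_exp_quad_iff (div_ne_zero h0 h0') (div_ne_zero h0' h0) M.k₂ (-M.k₁)
  have h1 : M.Sφ = mulOp fun p => M.Nφ / M.NΨ * Real.exp (quad M.k₂ (-M.k₁) p) := by
    simp only [Sφ, quad]; congr! 5; ring
  have h2 : M.SΨ = mulOp fun p => M.NΨ / M.Nφ * Real.exp (quad (-M.k₂) (-(-M.k₁)) p) := by
    simp only [SΨ, quad]; congr! 5; ring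
  rw [h1, h2, this]
  simp

lemma φ_zero_ne (h : M.IsAdmissible) (h0 : M.Nφ ≠ 0) : M.φ (0, 0) ≠ 0 := by
  rw [φ, sφ_zero, Ne, map_eq_zero_iff incl incl_injective]
  intro hv
  have h1 := congrArg (fun f : Sch => f 0) hv
  simp only [vac_apply h, vacφ] at h1
  exact mul_ne_zero h0 (ofReal_ne_zero.2 (Real.exp_pos _).ne') h1

lemma dual_k_iff : (M.dual.k₁ = 0 ∧ M.dual.k₂ = 0) ↔ (M.k₁ = 0 ∧ M.k₂ = 0) := by simp [dual]

end Model

end Landau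

end

theorem mainTheorem6 (M : Landau.Model)
    (hk₁ : -1 / 2 < M.k₁ ∧ M.k₁ < 1 / 2) (hk₂ : -1 / 2 < M.k₂ ∧ M.k₂ < 1 / 2)
    (hαγ : M.α * M.γ = 1 / 2) (hαγ' : M.α' * M.γ' = 1 / 2)
    (hN : ∫ p : ℝ × ℝ, conj (M.vacφ p) * M.vacΨ p = 1) :
    -- commutation rules and factorisation of the Hamiltonians, on Schwartz functions
    (∀ f : Landau.Sch,
      M.sA (M.sB f) - M.sB (M.sA f) = f ∧ M.sA' (M.sB' f) - M.sB' (M.sA' f) = f ∧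
      M.sA (M.sA' f) = M.sA' (M.sA f) ∧ M.sA (M.sB' f) = M.sB' (M.sA f) ∧
      M.sB (M.sA' f) = M.sA' (M.sB f) ∧ M.sB (M.sB' f) = M.sB' (M.sB f) ∧
      M.sH f = M.sB (M.sA f) + (1 / 2 : ℂ) • f ∧
      M.sH' f = M.sB' (M.sA' f) + (1 / 2 : ℂ) • f) ∧
    -- the domain shared by the operators in `L²(ℝ²)` is dense
    Dense (LinearMap.range Landau.incl : Set Landau.Hil) ∧
    -- the families exist: `φ₀` belongs to the unperturbed model
    ∃ φ Ψ φ₀ : ℕ × ℕ → Landau.Hil,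
      M.IsφFamily φ ∧ M.IsΨFamily Ψ ∧ Landau.sll.IsφFamily φ₀ ∧
      -- vacua
      φ (0, 0) ≠ 0 ∧ Landau.Maps M.A (φ (0, 0)) 0 ∧ Landau.Maps M.A' (φ (0, 0)) 0 ∧
      Landau.MemDInf M.B (φ (0, 0)) ∧ Landau.MemDInf M.B' (φ (0, 0)) ∧
      Ψ (0, 0) ≠ 0 ∧ Landau.Maps M.B† (Ψ (0, 0)) 0 ∧ Landau.Maps M.B'† (Ψ (0, 0)) 0 ∧
      Landau.MemDInf M.A† (Ψ (0, 0)) ∧ Landau.MemDInf M.A'† (Ψ (0, 0)) ∧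
      -- biorthonormality and completeness
      (∀ i j : ℕ × ℕ, inner ℂ (Ψ i) (φ j) = if i = j then 1 else 0) ∧
      Landau.IsCompleteFamily φ ∧ Landau.IsCompleteFamily Ψ ∧
      Orthonormal ℂ φ₀ ∧ Landau.IsCompleteFamily φ₀ ∧
      -- diagonalisation
      (∀ n l : ℕ,
        Landau.Maps M.N (φ (n, l)) ((l : ℂ) • φ (n, l)) ∧
        Landau.Maps M.N' (φ (n, l)) ((n : ℂ) • φ (n, l)) ∧
        Landau.Maps M.N† (Ψ (n, l)) ((l : ℂ) • Ψ (n, l)) ∧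
        Landau.Maps M.N'† (Ψ (n, l)) ((n : ℂ) • Ψ (n, l)) ∧
        Landau.Maps (Landau.prodOp M.A† M.B†) (Ψ (n, l)) ((l : ℂ) • Ψ (n, l)) ∧
        Landau.Maps (Landau.prodOp M.A'† M.B'†) (Ψ (n, l)) ((n : ℂ) • Ψ (n, l)) ∧
        Landau.Maps M.h (φ (n, l)) ((l + 1 / 2 : ℂ) • φ (n, l)) ∧
        Landau.Maps M.h' (φ (n, l)) ((n + 1 / 2 : ℂ) • φ (n, l)) ∧
        Landau.Maps M.h† (Ψ (n, l)) ((l + 1 / 2 : ℂ) • Ψ (n, l)) ∧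
        Landau.Maps M.h'† (Ψ (n, l)) ((n + 1 / 2 : ℂ) • Ψ (n, l))) ∧
      -- the multiplication operators relate the families
      (∀ n l : ℕ,
        Landau.Maps M.Tφ (((√2 * M.γ') ^ n * (√2 * M.γ) ^ l) • φ₀ (n, l)) (φ (n, l)) ∧
        Landau.Maps M.TΨ (((√2 * conj M.α') ^ n * (√2 * conj M.α) ^ l) • φ₀ (n, l)) (Ψ (n, l)) ∧
        Landau.Maps M.Sφ (Ψ (n, l)) (((conj M.α' / M.γ') ^ n * (conj M.α / M.γ) ^ l) • φ (n, l)) ∧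
        Landau.Maps M.SΨ (φ (n, l)) (((M.γ' / conj M.α') ^ n * (M.γ / conj M.α) ^ l) • Ψ (n, l))) ∧
      -- and intertwine the number operators with their adjoints
      Landau.IntertwinesOn (Submodule.span ℂ (Set.range φ)) M.SΨ M.N M.N† ∧
      Landau.IntertwinesOn (Submodule.span ℂ (Set.range φ)) M.SΨ M.N' M.N'† ∧
      Landau.IntertwinesOn (Submodule.span ℂ (Set.range Ψ)) M.Sφ M.N† M.N ∧
      Landau.IntertwinesOn (Submodule.span ℂ (Set.range Ψ)) M.Sφ M.N'† M.N' ∧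
      -- they are bounded with bounded inverse only in the unperturbed case
      ((Landau.IsBoundedOp M.Tφ ∧ Landau.IsBoundedOp M.TφInv) ↔ (M.k₁ = 0 ∧ M.k₂ = 0)) ∧
      ((Landau.IsBoundedOp M.TΨ ∧ Landau.IsBoundedOp M.TΨInv) ↔ (M.k₁ = 0 ∧ M.k₂ = 0)) ∧
      ((Landau.IsBoundedOp M.Sφ ∧ Landau.IsBoundedOp M.SΨ) ↔ (M.k₁ = 0 ∧ M.k₂ = 0)) ∧
      -- neither family is a Riesz basis outside the unperturbed case
      (¬ (M.k₁ = 0 ∧ M.k₂ = 0) → ¬ Landau.IsRieszBasis φ ∧ ¬ Landau.IsRieszBasis Ψ) := by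
  have h : M.IsAdmissible := ⟨hk₁, hk₂, hαγ, hαγ'⟩
  obtain ⟨hφ0, hΨ0⟩ := Landau.Model.ne_zero_of_integral hN
  have h0 := Landau.Model.pairing_vac h hN
  have h0' : Landau.Model.pairing M.dual.dual.vac M.dual.vac = 1 := by
    rw [M.dual_dual, Landau.Model.pairing_eq_inner, ← inner_conj_symm,
      ← Landau.Model.pairing_eq_inner, h0, map_one]
  have hN1 : ∀ i : ℕ × ℕ, Landau.Maps M.N (M.φ i) ((i.2 : ℂ) • M.φ i) := fun i => by
    have := Landau.maps_prodOp_onL2 M.sB M.sA (M.sφ i)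
    rwa [Landau.Model.sB_sA_sφ h, map_smul] at this
  have hN1' : ∀ i : ℕ × ℕ, Landau.Maps M.N' (M.φ i) ((i.1 : ℂ) • M.φ i) := fun i => by
    have := Landau.maps_prodOp_onL2 M.sB' M.sA' (M.sφ i)
    rwa [Landau.Model.sB'_sA'_sφ h, map_smul] at this
  have hN2 : ∀ i : ℕ × ℕ, Landau.Maps M.N† (M.dual.φ i) ((i.2 : ℂ) • M.dual.φ i) := fun i => by
    have := M.isAdj_sB.maps_prodOp M.isAdj_sA (M.dual.sφ i)
    rwa [Landau.Model.sB_sA_sφ h.dual, map_smul] at this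
  have hN2' : ∀ i : ℕ × ℕ, Landau.Maps M.N'† (M.dual.φ i) ((i.1 : ℂ) • M.dual.φ i) := fun i => by
    have := M.isAdj_sB'.maps_prodOp M.isAdj_sA' (M.dual.sφ i)
    rwa [Landau.Model.sB'_sA'_sφ h.dual, map_smul] at this
  -- The relations starting from the dual model become those for `TΨ` and `SΨ` once the double dual
  -- is removed.
  have hTΨ := fun n l => Landau.Model.maps_Tφ h.dual n l
  have hSφ := Landau.Model.maps_Sφ h hΨ0
  have hSΨ := fun n l => Landau.Model.maps_Sφ h.dual hφ0 n l
  simp only [M.Tφ_dual, M.Sφ_dual, M.dual_dual] at hTΨ hSΨ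
  refine ⟨fun f => ⟨M.sA_sB hαγ f, M.sA'_sB' hαγ' f, M.sA_sA' f, M.sA_sB' f, M.sB_sA' f, M.sB_sB' f,
    M.sH_eq hαγ f, M.sH'_eq hαγ' f⟩, Landau.dense_range_incl, M.φ, M.dual.φ, Landau.sll.φ,
    Landau.Model.isφFamily h, Landau.Model.isΨFamily_dual h, Landau.Model.isφFamily .sll,
    Landau.Model.φ_zero_ne h hφ0, ?_, ?_, ?_, ?_, Landau.Model.φ_zero_ne h.dual hΨ0, ?_, ?_, ?_, ?_,
    Landau.Model.inner_dual_φ h h0, Landau.Model.isCompleteFamily_φ h hφ0,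
    Landau.Model.isCompleteFamily_φ h.dual hΨ0, Landau.Model.orthonormal_sll,
    Landau.Model.isCompleteFamily_φ .sll
      (Landau.Model.ne_zero_of_integral Landau.Model.integral_vac_sll).1,
    fun n l => ⟨hN1 (n, l), hN1' (n, l), hN2 (n, l), hN2' (n, l), ?_, ?_, ?_, ?_, ?_, ?_⟩,
    fun n l => ⟨Landau.Model.maps_Tφ h n l, hTΨ n l, hSφ n l, ?_⟩, ?_, ?_, ?_, ?_,
    Landau.Model.isBoundedOp_Tφ_iff hφ0, ?_, Landau.Model.isBoundedOp_Sφ_iff hφ0 hΨ0,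
    fun hk => ⟨Landau.Model.not_isRieszBasis h hφ0 hΨ0 h0 hk,
      Landau.Model.not_isRieszBasis h.dual hΨ0 hφ0 h0' (mt Landau.Model.dual_k_iff.1 hk)⟩⟩
  · have := Landau.maps_onL2 M.sA M.vac
    rwa [Landau.Model.sA_vac h, map_zero, ← Landau.Model.sφ_zero] at this
  · have := Landau.maps_onL2 M.sA' M.vac
    rwa [Landau.Model.sA'_vac h, map_zero, ← Landau.Model.sφ_zero] at this
  · exact Landau.Model.memDInf_of_maps (Landau.maps_onL2 M.sB) _
  · exact Landau.Model.memDInf_of_maps (Landau.maps_onL2 M.sB') _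
  · have := M.isAdj_sB.maps_onL2 M.dual.vac
    rwa [Landau.Model.sA_vac h.dual, map_zero, ← Landau.Model.sφ_zero] at this
  · have := M.isAdj_sB'.maps_onL2 M.dual.vac
    rwa [Landau.Model.sA'_vac h.dual, map_zero, ← Landau.Model.sφ_zero] at this
  · exact Landau.Model.memDInf_of_maps M.isAdj_sA.maps_onL2 _
  · exact Landau.Model.memDInf_of_maps M.isAdj_sA'.maps_onL2 _
  · have := (M.isAdj_sB.maps_onL2 (M.dual.sφ (n, l))).prodOp (M.isAdj_sA.maps_onL2 _)
    rwa [Landau.Model.sB_sA_sφ h.dual, map_smul] at this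
  · have := (M.isAdj_sB'.maps_onL2 (M.dual.sφ (n, l))).prodOp (M.isAdj_sA'.maps_onL2 _)
    rwa [Landau.Model.sB'_sA'_sφ h.dual, map_smul] at this
  · have := Landau.maps_onL2 M.sH (M.sφ (n, l))
    rwa [Landau.Model.sH_sφ h, map_smul] at this
  · have := Landau.maps_onL2 M.sH' (M.sφ (n, l))
    rwa [Landau.Model.sH'_sφ h, map_smul] at this
  · have := (Landau.Model.isAdj_sH h).maps_onL2 (M.dual.sφ (n, l))
    rwa [Landau.Model.sH_sφ h.dual, map_smul] at this
  · have := (Landau.Model.isAdj_sH' h).maps_onL2 (M.dual.sφ (n, l))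
    rwa [Landau.Model.sH'_sφ h.dual, map_smul] at this
  · simpa [Landau.Model.dual] using hSΨ n l
  · refine .of_span ?_
    rintro _ ⟨⟨n, l⟩, rfl⟩
    -- The image under `SΨ` is only a scalar multiple of `Ψ_{n,l}`, but it is an eigenvector for the
    -- same eigenvalue.
    exact (hSΨ n l).intertwine (hN1 _) (by
      rw [smul_comm]; exact (hN2 (n, l)).smul _)
  · refine .of_span ?_
    rintro _ ⟨⟨n, l⟩, rfl⟩
    exact (hSΨ n l).intertwine (hN1' _) (by
      rw [smul_comm]; exact (hN2' (n, l)).smul _)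
  · refine .of_span ?_
    rintro _ ⟨⟨n, l⟩, rfl⟩
    exact (hSφ n l).intertwine (hN2 _) (by
      rw [smul_comm]; exact (hN1 (n, l)).smul _)
  · refine .of_span ?_
    rintro _ ⟨⟨n, l⟩, rfl⟩
    exact (hSφ n l).intertwine (hN2' _) (by
      rw [smul_comm]; exact (hN1' (n, l)).smul _)
  · rw [← M.Tφ_dual, ← M.TφInv_dual, ← Landau.Model.dual_k_iff]
    exact Landau.Model.isBoundedOp_Tφ_iff hΨ0
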